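/- **Expected complexity of $\mathrm{QMax}_\infty$.** *Algorithms.* Let $L$ be a list of $n=|L|\ge 1$ items and $R:L\to\mathbb R$ any function (ties allowed). For $i,j\in L$ put $f_i(j)=1$ if $R(j)>R(i)$ and $f_i(j)=0$ otherwise. Given $g:L\to\{0,1\}$, an item $x$ is *marked* if $g(x)=1$, and a *Grover iteration* for $g$ is the unitary $(2|u\rangle\langle u|-1)\,S_g$ on $\mathbb C^L$, where $u$ is the uniform superposition of all items and $S_g|x\rangle=(-1)^{g(x)}|x\rangle$; it uses the quantum oracle of $g$ once. $\mathrm{QSearch}_\infty$ for $g$: set $\lambda=6/5$ and $m=\lambda$. Repeat the following cycle: choose $j$ uniformly among the non-negative integers smaller than $m$; apply $j$ Grover iterations to $u$; measure, observing an item $x$; if $x$ is marked, return it, otherwise replace $m$ by $\min(\lambda m,\sqrt n)$. $\mathrm{QMax}_\infty$: choose $y\in L$ uniformly at random; then repeatedly run $\mathrm{QSearch}_\infty$ for $g=f_y$ and replace $y$ by the item it returns. The maximum has been *found* when $y$ maximises $R$. *Counting.* One use of the quantum oracle of any $f_i$ costs $c_q$ queries to $f_i$, and the check at the end of a cycle whether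 the observed item is marked costs $k$ queries, where $c_q,k$ are integers with $1\le k\le c_q$. Thus a cycle with $j$ iterations costs $c_q j+k$ queries: $k=1$ is the actual number of queries, while $k=c_q$ charges every check like a use of the oracle. Let $E$ be the expected number of queries made by $\mathrm{QMax}_\infty$ until it has found the maximum. *Statement.* For $1\le t\le n$ let $$F(n,t)=\begin{cases}\dfrac94\dfrac{n}{\sqrt{(n-t)t}}+\left\lceil\log_{6/5}\!\left(\dfrac{n}{2\sqrt{(n-t)t}}\right)\right\rceil-3 & \text{if } 1\le t<\frac n4,\\[2mm] 2.0344 & \text{if } \frac n4\le t\le n.\end{cases}$$ (1) If $n\ge5$ or $c_q\ge 2k$, then $$E\le c_q\sum_{t=1}^{n-1}\frac{F(n,t)}{t+1}$$ and $$E\le c_q\left(\frac{9.2\sqrt n}{3}\sum_{t=1}^{\lceil n/4\rceil-1}\frac1{\sqrt t\,(t+1)}+2.0344\sum_{t=\lceil n/4\rceil}^{n-1}\frac1{t+1}\right).$$ (2) For all $n\ge1$, $$E\le c_q\left(6.3505\sqrt n+2.8203\right)$$ and $$E\le c_q\left[\frac{3\sqrt3(1+\pi)}4\sqrt n+\frac{\ln(n/4)}{2\ln(6/5)}\Bigl(\ln(n/3)+\ln(n/4+1)\Bigr)-2\ln(n/4)+5.3482+\frac{\mathrm{Li}_2(-\lceil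 n/4\rceil+1)}{2\ln(6/5)}\right],$$ where $\mathrm{Li}_2(x)=-\int_0^x\frac{\ln(1-s)}{s}\,ds$ is the dilogarithm. -/

import Mathlib

open scoped BigOperators ENNReal

noncomputable section

namespace QMax

/-! ### Grover cycles on the index register of a list -/

section Grover

variable {ι : Type*} [Fintype ι]

/-- The uniform superposition of all items of the list. -/
def uniformState (ι : Type*) [Fintype ι] : ι → ℂ :=
  fun _ => ((1 / Real.sqrt (Fintype.card ι) : ℝ) : ℂ)

/-- One use of the oracle of `g` as a phase: the reflection through the unmarked basis states,
`|x⟩ ↦ (-1)^{g x} |x⟩`. -/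
def oracleReflection (g : ι → Bool) (ψ : ι → ℂ) : ι → ℂ :=
  fun x => if g x then -ψ x else ψ x

/-- The reflection `2 |u⟩⟨u| - 1` through the uniform superposition `u`. -/
def uniformReflection (ψ : ι → ℂ) : ι → ℂ :=
  fun x => 2 * (∑ y, star (uniformState ι y) * ψ y) * uniformState ι x - ψ x

/-- One Grover iteration; it uses the oracle of `g` exactly once. -/
def groverIteration (g : ι → Bool) (ψ : ι → ℂ) : ι → ℂ :=
  uniformReflection (oracleReflection g ψ)

/-- The state of the register after `j` Grover iterations on the uniform superposition. -/
def groverState (g : ι → Bool) (j : ℕ) : ι → ℂ :=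
  (groverIteration g)^[j] (uniformState ι)

lemma uniformState_normSq [Nonempty ι] : ∑ x, ‖uniformState ι x‖ ^ 2 = 1 := by
  have hpos : (0 : ℝ) < Fintype.card ι := by exact_mod_cast Fintype.card_pos
  have h : ∀ x : ι, ‖uniformState ι x‖ ^ 2 = 1 / (Fintype.card ι : ℝ) := by
    intro x
    rw [uniformState, Complex.norm_real, Real.norm_eq_abs, sq_abs, div_pow,
      Real.sq_sqrt hpos.le, one_pow]
  simp only [h, Finset.sum_const, Finset.card_univ, nsmul_eq_mul]
  field_simp

lemma oracleReflection_normSq (g : ι → Bool) (ψ : ι → ℂ) :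
    ∑ x, ‖oracleReflection g ψ x‖ ^ 2 = ∑ x, ‖ψ x‖ ^ 2 := by
  refine Finset.sum_congr rfl fun x _ => ?_
  unfold oracleReflection
  split_ifs <;> simp

lemma uniformReflection_normSq [Nonempty ι] (ψ : ι → ℂ) :
    ∑ x, ‖uniformReflection ψ x‖ ^ 2 = ∑ x, ‖ψ x‖ ^ 2 := by
  have key : ∀ φ : ι → ℂ, ((∑ x, ‖φ x‖ ^ 2 : ℝ) : ℂ) = ∑ x, star (φ x) * φ x := by
    intro φ
    push_cast
    refine Finset.sum_congr rfl fun x _ => ?_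
    rw [← Complex.conj_mul']
    rfl
  have hu : ∑ x, star (uniformState ι x) * uniformState ι x = 1 := by
    rw [← key, uniformState_normSq]
    simp
  apply Complex.ofReal_injective
  rw [key, key]
  set c : ℂ := ∑ y, star (uniformState ι y) * ψ y with hc
  have hc' : star c = ∑ y, star (ψ y) * uniformState ι y := by
    rw [hc, star_sum]
    refine Finset.sum_congr rfl fun x _ => ?_
    rw [star_mul', star_star, mul_comm]
  have hterm : ∀ x, star (uniformReflection ψ x) * uniformReflection ψ x
      = 4 * (star c * c) * (star (uniformState ι x) * uniformState ι x)
        - 2 * star c * (star (uniformState ι x) * ψ x)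
        - 2 * c * (star (ψ x) * uniformState ι x) + star (ψ x) * ψ x := by
    intro x
    simp only [uniformReflection, ← hc, star_sub, star_mul', star_ofNat]
    ring
  simp only [hterm, Finset.sum_add_distrib, Finset.sum_sub_distrib, ← Finset.mul_sum, hu, ← hc,
    ← hc']
  ring

lemma groverState_normSq [Nonempty ι] (g : ι → Bool) (j : ℕ) :
    ∑ x, ‖groverState g j x‖ ^ 2 = 1 := by
  induction j with
  | zero => exact uniformState_normSq
  | succ j ih =>
    rw [groverState, Function.iterate_succ_apply', groverIteration, uniformReflection_normSq,
      oracleReflection_normSq]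
    exact ih

/-- A Grover cycle with `j` iterations: the law of the item observed when the register is measured
after `j` Grover iterations on the uniform superposition. -/
def groverCycle [Nonempty ι] (g : ι → Bool) (j : ℕ) : PMF ι :=
  PMF.ofFintype (fun x => ENNReal.ofReal (‖groverState g j x‖ ^ 2)) (by
    rw [← ENNReal.ofReal_sum_of_nonneg (fun x _ => sq_nonneg _), groverState_normSq,
      ENNReal.ofReal_one])

end Grover

/-! ### The search algorithm `QSearch_∞` and the maximum finding algorithm `QMax_∞` -/

/-- The value of the variable `m` of `QSearch_∞` on a list of `n` items after `u` failed cycles: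
it starts at `λ = 6/5` and is replaced by `min (λ m) √n` after each failure. -/
def searchRange (n : ℕ) : ℕ → ℝ
  | 0 => 6 / 5
  | u + 1 => min (6 / 5 * searchRange n u) (Real.sqrt n)

lemma searchRange_pos {n : ℕ} (hn : 0 < n) (u : ℕ) : 0 < searchRange n u := by
  induction u with
  | zero => norm_num [searchRange]
  | succ u ih =>
    have : (0 : ℝ) < n := by exact_mod_cast hn
    exact lt_min (by positivity) (Real.sqrt_pos.2 this)

section Algorithms

variable {ι : Type*} [Fintype ι] [Nonempty ι]

lemma range_searchRange_nonempty (ι : Type*) [Fintype ι] [Nonempty ι] (u : ℕ) :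
    (Finset.range ⌈searchRange (Fintype.card ι) u⌉₊).Nonempty := by
  rw [Finset.nonempty_range_iff]
  exact (Nat.ceil_pos.2 (searchRange_pos Fintype.card_pos u)).ne'

/-- The cycle of `QSearch_∞` that follows `u` failed cycles: `j` is uniform among the non-negative
integers smaller than `m` (these are the elements of `range ⌈m⌉`), and a Grover cycle with `j`
iterations is run. The outcome is the pair of `j` and the observed item. -/
def searchCycle (g : ι → Bool) (u : ℕ) : PMF (ℕ × ι) :=
  (PMF.uniformOfFinset (Finset.range ⌈searchRange (Fintype.card ι) u⌉₊)
    (range_searchRange_nonempty ι u)).bind fun j => (groverCycle g j).map fun x => (j, x)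

open Classical in
/-- The marking function `f_i`: the item `j` is marked when `R j > R i`. -/
def marking (R : ι → ℝ) (i j : ι) : Bool := decide (R i < R j)

/-- A configuration of `QMax_∞`: the current threshold item, the number of failed cycles in the
current call of `QSearch_∞`, and the number of queries made so far to the marking functions. -/
structure Config (ι : Type*) where
  threshold : ι
  failed : ℕ
  queries : ℕ

open Classical in
/-- One cycle of `QMax_∞`. As long as the threshold item `y` does not maximise `R`, the next cycle
of the running call of `QSearch_∞` for the items marked by `f_y` is executed. It makes `cq` queries
for each of its `j` Grover iterations and `k` queries for checking whether the observed item is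
marked. If it is, it becomes the new threshold and a new call of `QSearch_∞` starts. Nothing is
counted any more once the maximum has been found. -/
def step (R : ι → ℝ) (cq k : ℕ) (s : Config ι) : PMF (Config ι) :=
  if ∀ z, R z ≤ R s.threshold then PMF.pure s
  else (searchCycle (marking R s.threshold) s.failed).map fun p =>
    if marking R s.threshold p.2 then ⟨p.2, 0, s.queries + (cq * p.1 + k)⟩
    else ⟨s.threshold, s.failed + 1, s.queries + (cq * p.1 + k)⟩

/-- The law of the configuration of `QMax_∞` after `N` cycles, from a uniformly random threshold. -/
def law (R : ι → ℝ) (cq k : ℕ) : ℕ → PMF (Config ι)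
  | 0 => (PMF.uniformOfFintype ι).map fun y => ⟨y, 0, 0⟩
  | N + 1 => (law R cq k N).bind (step R cq k)

/-- The expected number of queries that `QMax_∞` makes until it has found the maximum of `R`.
The number of queries made within the first `N` cycles is nondecreasing in `N`, so that the expected
total is the supremum of the expected values for finite `N`. -/
def expectedQueries (R : ι → ℝ) (cq k : ℕ) : ℝ≥0∞ :=
  ⨆ N : ℕ, ∑' s : Config ι, law R cq k N s * (s.queries : ℝ≥0∞)

end Algorithms

/-! ### The functions in the bounds -/

/-- The function `F(n, t)` for a list of `n` items, `t` of which are marked, `1 ≤ t ≤ n`. -/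
def F (n t : ℕ) : ℝ :=
  if (t : ℝ) < (n : ℝ) / 4 then
    9 / 4 * ((n : ℝ) / Real.sqrt (((n : ℝ) - t) * t))
      + (⌈Real.logb (6 / 5) ((n : ℝ) / (2 * Real.sqrt (((n : ℝ) - t) * t)))⌉ : ℝ) - 3
  else 2.0344

/-- The dilogarithm `Li₂ x = -∫₀ˣ log (1 - s) / s ds`, for `x ≤ 1`. -/
def dilog (x : ℝ) : ℝ := -∫ s in (0 : ℝ)..x, Real.log (1 - s) / s

end QMax

end

noncomputable section

namespace QMax

/-! ### Reduction of Grover's iteration to two amplitudes -/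

section Amplitudes

variable {K : Type*} [Field K]

/-! If `t` of `n` items are marked and `sin² θ = t / n`, a Grover iteration rotates the plane of
states that are constant on marked and on unmarked items by `2θ`. A cycle with `j` iterations
succeeds with probability `sin² ((2j + 1)θ)`, and averaging over `j < M` gives `1/2 - sin (4Mθ) /
(4M sin 2θ)`. All marked items are equally likely, so a successful search moves the threshold to a
uniform item above the old one. Without ties, rank `r` is visited with probability `1 / (r + 1)`,
which explains the weights in every bound.

`expectedQueries_le_of_potential` turns this into a supermartingale. Let `V t u` satisfy the
one-cycle inequality of a search with `t` marked items after `u` failures, and let `G t ≥ V t 0`.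
Then the queries made so far plus `cq` times `V t u + ∑_{1 ≤ r < t} G r / (r + 1)` do not increase
in expectation, and the initial average gives the bound `cq * ∑ G t / (t + 1)`. Ties only lower
ranks; they are harmless once the cost of a fresh start is monotone in the rank, which is the
condition that `t * G t` is nondecreasing.

It remains to choose `V` and `G`. For `n ≥ 5`, `searchPotential` unrolls the first three cycles
exactly and then uses an explicit function of the range `m`, verified with three lower bounds for
the averaged success probability. `searchBound` is the resulting closed `G`. It exceeds `F` for
large `t`, but for `n ≥ 80` the loss, at most a multiple of `log 2`, is repaid by the terms `t ≤ 4`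
(`sum_searchBound_le_sum_F`). For `n < 80` a table of `V` and `G` is computed in integer arithmetic
with outward rounding and checked by the kernel. For `2 ≤ n ≤ 4` the comparison with `F` charges
half an oracle use per check, which is what `2 * k ≤ cq` allows.

The second bound of (1) follows from `F_le_sqrt`. For `n ≥ 5` both bounds of (2) follow from the
stronger `5.37 √n + 2.4`; for the last one, an elementary lower bound for the dilogarithm nearly
cancels the product of logarithms. For `2 ≤ n ≤ 4` the cost is at most `4 * cq`, and for `n = 1` it
is zero. -/

/-- The amplitudes, in units of `1 / √n`, of the marked and of the unmarked items after `j` Grover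
iterations, when a proportion `a` of the items is marked. -/
def amplitude (a : K) : ℕ → K × K
  | 0 => (1, 1)
  | j + 1 => ((1 - 2 * a) * (amplitude a j).1 + 2 * (1 - a) * (amplitude a j).2,
      (1 - 2 * a) * (amplitude a j).2 - 2 * a * (amplitude a j).1)

/-- The success probability of a Grover cycle with `j` iterations, when a proportion `a` of the
items is marked. -/
def successProb (a : K) (j : ℕ) : K := a * (amplitude a j).1 ^ 2

/-- The success probability of a cycle in which the number of Grover iterations is uniform among
the natural numbers smaller than `M`. -/
def avgSuccess (a : K) (M : ℕ) : K := (∑ j ∈ Finset.range M, successProb a j) / M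

lemma amplitude_normSq (a : K) (j : ℕ) :
    a * (amplitude a j).1 ^ 2 + (1 - a) * (amplitude a j).2 ^ 2 = 1 := by
  induction j with
  | zero => simp [amplitude]
  | succ j ih =>
    simp only [amplitude]
    linear_combination ih

end Amplitudes

section Grover

variable {ι : Type*} [Fintype ι] [Nonempty ι]

/-- The number of marked items. -/
def markedCount (g : ι → Bool) : ℕ := (Finset.univ.filter fun x => g x = true).card

/-- Both reflections preserve the states that are constant on the marked and on the unmarked items,
and the uniform state is one of them. -/
lemma groverState_eq_amplitude (g : ι → Bool) (j : ℕ) (x : ι) :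
    groverState g j x =
      (((if g x then (amplitude ((markedCount g : ℝ) / Fintype.card ι) j).1
        else (amplitude ((markedCount g : ℝ) / Fintype.card ι) j).2)
          / Real.sqrt (Fintype.card ι) : ℝ) : ℂ) := by
  set a : ℝ := (markedCount g : ℝ) / Fintype.card ι with ha
  have hpos : (0 : ℝ) < Fintype.card ι := by exact_mod_cast Fintype.card_pos
  induction j generalizing x with
  | zero => simp [groverState, uniformState, amplitude]
  | succ j ih =>
    have hs : groverState g (j + 1) = groverIteration g (groverState g j) := by
      rw [groverState, Function.iterate_succ_apply']; rfl
    set d := (amplitude a j).1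
    set e := (amplitude a j).2
    have hor : ∀ y, oracleReflection g (groverState g j) y =
        (((if g y then -d else e) / Real.sqrt (Fintype.card ι) : ℝ) : ℂ) := by
      intro y
      rw [oracleReflection, ih]
      split_ifs <;> push_cast <;> ring
    have hcard : (Finset.univ.filter fun y => ¬ g y = true).card
        = (Fintype.card ι : ℝ) - markedCount g := by
      have := Finset.card_filter_add_card_filter_not (s := (Finset.univ : Finset ι))
        (fun y => g y = true)
      rw [eq_sub_iff_add_eq', markedCount]
      exact_mod_cast this
    have hsum : ∑ y, star (uniformState ι y) * oracleReflection g (groverState g j) y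
        = (((1 - a) * e - a * d : ℝ) : ℂ) := by
      have : ∀ y, star (uniformState ι y) * oracleReflection g (groverState g j) y
          = (((if g y then -d else e) / Fintype.card ι : ℝ) : ℂ) := by
        intro y
        rw [hor, uniformState, Complex.star_def, Complex.conj_ofReal, ← Complex.ofReal_mul]
        congr 1
        rw [div_mul_div_comm, Real.mul_self_sqrt hpos.le, one_mul]
      simp only [this]
      rw [← Complex.ofReal_sum, ← Finset.sum_div, Finset.sum_ite, Finset.sum_const,
        Finset.sum_const, nsmul_eq_mul, nsmul_eq_mul, hcard]
      congr 1
      rw [ha, markedCount]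
      field_simp
      ring
    rw [hs, groverIteration, uniformReflection, hsum, hor, uniformState]
    rw [show (2 : ℂ) = ((2 : ℝ) : ℂ) by norm_num, ← Complex.ofReal_mul, ← Complex.ofReal_mul,
      ← Complex.ofReal_sub]
    congr 1
    have hd : (amplitude a (j + 1)).1 = (1 - 2 * a) * d + 2 * (1 - a) * e := rfl
    have he : (amplitude a (j + 1)).2 = (1 - 2 * a) * e - 2 * a * d := rfl
    rw [hd, he]
    split_ifs <;> ring

/-- The probability, as a real number, that a Grover cycle with `j` iterations observes `x`. -/
def cycleProb (g : ι → Bool) (j : ℕ) (x : ι) : ℝ := ‖groverState g j x‖ ^ 2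

lemma groverCycle_apply (g : ι → Bool) (j : ℕ) (x : ι) :
    groverCycle g j x = ENNReal.ofReal (cycleProb g j x) := rfl

lemma cycleProb_nonneg (g : ι → Bool) (j : ℕ) (x : ι) : 0 ≤ cycleProb g j x := sq_nonneg _

lemma sum_cycleProb (g : ι → Bool) (j : ℕ) : ∑ x, cycleProb g j x = 1 := groverState_normSq g j

/-- The right side does not depend on `x`: given success, the observed item is uniform among the
marked ones. -/
lemma cycleProb_of_marked {g : ι → Bool} {j : ℕ} {x : ι} (hx : g x = true) :
    cycleProb g j x
      = successProb ((markedCount g : ℝ) / Fintype.card ι) j / markedCount g := by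
  have hpos : (0 : ℝ) < Fintype.card ι := by exact_mod_cast Fintype.card_pos
  have hm : (0 : ℝ) < markedCount g := by
    have : 0 < markedCount g := Finset.card_pos.2 ⟨x, by simp [hx]⟩
    exact_mod_cast this
  rw [cycleProb, groverState_eq_amplitude, Complex.norm_real, Real.norm_eq_abs, sq_abs, if_pos hx,
    div_pow, Real.sq_sqrt hpos.le, successProb]
  field_simp

lemma sum_cycleProb_marked {g : ι → Bool} (j : ℕ) (hg : 0 < markedCount g) :
    ∑ x with g x = true, cycleProb g j x
      = successProb ((markedCount g : ℝ) / Fintype.card ι) j := by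
  have hm : (0 : ℝ) < markedCount g := by exact_mod_cast hg
  rw [Finset.sum_congr rfl fun x hx => cycleProb_of_marked (Finset.mem_filter.1 hx).2,
    Finset.sum_const, nsmul_eq_mul]
  exact mul_div_cancel₀ _ hm.ne'

lemma sum_cycleProb_unmarked {g : ι → Bool} (j : ℕ) (hg : 0 < markedCount g) :
    ∑ x with ¬ g x = true, cycleProb g j x
      = 1 - successProb ((markedCount g : ℝ) / Fintype.card ι) j := by
  rw [← sum_cycleProb_marked j hg, ← sum_cycleProb g j, eq_sub_iff_add_eq']
  exact Finset.sum_filter_add_sum_filter_not _ _ _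

/-- The expected value, over the outcome of a Grover cycle, of a function that only depends on the
observed item when it is marked. -/
lemma sum_cycleProb_mul {g : ι → Bool} (j : ℕ) (hg : 0 < markedCount g) (h : ι → ℝ) (c : ℝ) :
    ∑ x, cycleProb g j x * (if g x then h x else c)
      = successProb ((markedCount g : ℝ) / Fintype.card ι) j
          * ((∑ x with g x = true, h x) / markedCount g)
        + (1 - successProb ((markedCount g : ℝ) / Fintype.card ι) j) * c := by
  rw [← Finset.sum_filter_add_sum_filter_not _ (fun x => g x = true)]
  congr 1
  · rw [Finset.sum_congr rfl fun x hx => by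
      rw [if_pos (Finset.mem_filter.1 hx).2, cycleProb_of_marked (Finset.mem_filter.1 hx).2],
      ← Finset.mul_sum]
    ring
  · rw [Finset.sum_congr rfl fun x hx => by rw [if_neg (Finset.mem_filter.1 hx).2],
      ← Finset.sum_mul, sum_cycleProb_unmarked j hg]

end Grover

/-! ### Expectations under composed distributions -/

lemma tsum_bind_mul {α β : Type*} (p : PMF α) (f : α → PMF β) (g : β → ℝ≥0∞) :
    ∑' b, p.bind f b * g b = ∑' a, p a * ∑' b, f a b * g b := by
  simp only [PMF.bind_apply, ← ENNReal.tsum_mul_right, ← ENNReal.tsum_mul_left]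
  rw [ENNReal.tsum_comm]
  simp only [mul_assoc]

lemma tsum_pure_mul {α : Type*} (a : α) (g : α → ℝ≥0∞) : ∑' b, PMF.pure a b * g b = g a := by
  rw [tsum_eq_single a fun b hb => by simp [PMF.pure_apply, hb]]
  simp

lemma tsum_map_mul {α β : Type*} (p : PMF α) (f : α → β) (g : β → ℝ≥0∞) :
    ∑' b, p.map f b * g b = ∑' a, p a * g (f a) := by
  rw [PMF.map, tsum_bind_mul]
  simp only [Function.comp, tsum_pure_mul]

/-! ### Ranks in the presence of ties -/

section Ranks

variable {ι : Type*}

/-- If the elements of a finite set of `t` elements are ranked by the number of elements above them,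
then the sum of a monotone function of the ranks is largest when there are no ties. -/
lemma sum_rank_le (R : ι → ℝ) {H : ℕ → ℝ} (N : ℕ) (hH : MonotoneOn H (Set.Iio N)) (S : Finset ι)
    (hS : S.card ≤ N) :
    ∑ x ∈ S, H ((S.filter fun z => R x < R z).card) ≤ ∑ i ∈ Finset.range S.card, H i := by
  classical
  induction hc : S.card generalizing S with
  | zero => simp [Finset.card_eq_zero.1 hc]
  | succ c ih =>
    have hne : S.Nonempty := Finset.card_pos.1 (by omega)
    obtain ⟨x₀, hx₀, hmin⟩ := S.exists_min_image R hne
    have hcard : (S.erase x₀).card = c := by rw [Finset.card_erase_of_mem hx₀, hc]; rfl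
    rw [Finset.sum_range_succ, ← Finset.sum_erase_add S _ hx₀]
    refine add_le_add ?_ ?_
    -- A minimal element lies above nothing, so erasing it leaves all other ranks unchanged; its own
    -- rank is at most `c`.
    · refine le_trans (le_of_eq ?_) (ih (S.erase x₀) (by omega) hcard)
      refine Finset.sum_congr rfl fun x hx => ?_
      congr 2
      ext z
      simp only [Finset.mem_filter, Finset.mem_erase]
      constructor
      · rintro ⟨hz, hlt⟩
        refine ⟨⟨?_, hz⟩, hlt⟩
        rintro rfl
        exact absurd hlt (not_lt.2 (hmin x (Finset.mem_of_mem_erase hx)))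
      · rintro ⟨⟨_, hz⟩, hlt⟩
        exact ⟨hz, hlt⟩
    · have hle : (S.filter fun z => R x₀ < R z).card ≤ c := by
        rw [← hcard]
        refine Finset.card_le_card fun z hz => ?_
        rw [Finset.mem_filter] at hz
        rw [Finset.mem_erase]
        refine ⟨?_, hz.1⟩
        rintro rfl
        exact lt_irrefl _ hz.2
      exact hH (by simp only [Set.mem_Iio]; omega) (by simp only [Set.mem_Iio]; omega) hle

variable [Fintype ι]

/-- The number of items that exceed the item `y`. -/
def rank (R : ι → ℝ) (y : ι) : ℕ := markedCount (marking R y)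

lemma marking_eq_true {R : ι → ℝ} {y x : ι} : marking R y x = true ↔ R y < R x := by
  simp [marking]

lemma rank_eq (R : ι → ℝ) (y : ι) :
    rank R y = (Finset.univ.filter fun z => R y < R z).card := by
  simp only [rank, markedCount, marking_eq_true]

lemma rank_lt (R : ι → ℝ) (y : ι) : rank R y < Fintype.card ι := by
  rw [rank_eq]
  refine lt_of_lt_of_eq (Finset.card_lt_card (t := Finset.univ) ?_) rfl
  rw [Finset.ssubset_univ_iff]
  intro h
  have := Finset.mem_univ y
  rw [← h, Finset.mem_filter] at this
  exact lt_irrefl _ this.2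

lemma rank_eq_zero {R : ι → ℝ} {y : ι} : rank R y = 0 ↔ ∀ z, R z ≤ R y := by
  rw [rank_eq, Finset.card_eq_zero, Finset.filter_eq_empty_iff]
  simp

lemma sum_rank_univ_le (R : ι → ℝ) {H : ℕ → ℝ}
    (hH : MonotoneOn H (Set.Iio (Fintype.card ι))) :
    ∑ x, H (rank R x) ≤ ∑ i ∈ Finset.range (Fintype.card ι), H i := by
  simp only [rank_eq]
  exact sum_rank_le R _ hH Finset.univ le_rfl

/-- Everything above a marked item is itself marked, so its rank within the marked set is its rank
in the whole list. -/
lemma sum_rank_marked_le (R : ι → ℝ) {H : ℕ → ℝ}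
    (hH : MonotoneOn H (Set.Iio (Fintype.card ι))) (y : ι) :
    ∑ x with marking R y x = true, H (rank R x) ≤ ∑ i ∈ Finset.range (rank R y), H i := by
  have h := sum_rank_le R _ hH (Finset.univ.filter fun x => marking R y x = true)
    (Finset.card_le_univ _)
  refine le_trans (le_of_eq (Finset.sum_congr rfl fun x hx => ?_)) h
  rw [rank_eq]
  congr 2
  ext z
  simp only [Finset.mem_filter, Finset.mem_univ, true_and, marking_eq_true] at hx ⊢
  exact ⟨fun hz => ⟨hx.trans hz, hz⟩, fun hz => hz.2⟩

end Ranks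

/-! ### The potential argument for the whole algorithm -/

section Search

variable {ι : Type*} [Fintype ι] [Nonempty ι]

lemma tsum_searchCycle_mul (g : ι → Bool) (u : ℕ) (h : ℕ × ι → ℝ) (hh : ∀ p, 0 ≤ h p) :
    ∑' p, searchCycle g u p * ENNReal.ofReal (h p)
      = ENNReal.ofReal ((∑ j ∈ Finset.range ⌈searchRange (Fintype.card ι) u⌉₊,
          ∑ x, cycleProb g j x * h (j, x)) / ⌈searchRange (Fintype.card ι) u⌉₊) := by
  classical
  set M := ⌈searchRange (Fintype.card ι) u⌉₊ with hM
  have hMpos : 0 < M := Nat.ceil_pos.2 (searchRange_pos Fintype.card_pos u)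
  have hMr : (0 : ℝ) < M := by exact_mod_cast hMpos
  have hinner : ∀ j, ∑' x, groverCycle g j x * ENNReal.ofReal (h (j, x))
      = ENNReal.ofReal (∑ x, cycleProb g j x * h (j, x)) := by
    intro j
    rw [tsum_fintype, ENNReal.ofReal_sum_of_nonneg fun x _ =>
      mul_nonneg (cycleProb_nonneg g j x) (hh _)]
    refine Finset.sum_congr rfl fun x _ => ?_
    rw [groverCycle_apply, ENNReal.ofReal_mul (cycleProb_nonneg g j x)]
  rw [searchCycle, tsum_bind_mul]
  simp only [tsum_map_mul, hinner]
  rw [tsum_eq_sum (s := Finset.range M) fun j hj => by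
    rw [PMF.uniformOfFinset_apply, if_neg hj, zero_mul]]
  rw [Finset.sum_div, ENNReal.ofReal_sum_of_nonneg fun j _ => div_nonneg
    (Finset.sum_nonneg fun x _ => mul_nonneg (cycleProb_nonneg g j x) (hh _)) hMr.le]
  refine Finset.sum_congr rfl fun j hj => ?_
  rw [PMF.uniformOfFinset_apply, if_pos hj, Finset.card_range, div_eq_inv_mul,
    ENNReal.ofReal_mul (inv_nonneg.2 hMr.le), ENNReal.ofReal_inv_of_pos hMr, ENNReal.ofReal_natCast]

lemma successProb_nonneg {a : ℝ} (ha : 0 ≤ a) (j : ℕ) : 0 ≤ successProb a j :=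
  mul_nonneg ha (sq_nonneg _)

/-- The expected number of queries in the cycle that follows `u` failed ones, in units of the cost
of the oracle, if a check costs `κ`. -/
def cycleCost (κ : ℝ) (n u : ℕ) : ℝ := ((⌈searchRange n u⌉₊ : ℝ) - 1) / 2 + κ

/-- The success probability of the cycle that follows `u` failed ones. -/
def cycleSuccess (n t u : ℕ) : ℝ := avgSuccess ((t : ℝ) / n) ⌈searchRange n u⌉₊

/-- A bound for the expected remaining cost once a search among `t` marked items has ended. -/
def tailCost (G : ℕ → ℝ) (t : ℕ) : ℝ := ∑ r ∈ Finset.Icc 1 (t - 1), G r / ((r : ℝ) + 1)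

lemma tailCost_succ (G : ℕ → ℝ) {t : ℕ} (ht : 1 ≤ t) :
    tailCost G (t + 1) = tailCost G t + G t / ((t : ℝ) + 1) := by
  obtain ⟨m, rfl⟩ : ∃ m, t = m + 1 := ⟨t - 1, by omega⟩
  simp only [tailCost, Nat.add_sub_cancel]
  rw [Finset.sum_Icc_succ_top (by omega)]

/-- The bound for the expected remaining cost when the threshold has rank `t` and a new search
starts. -/
def startCost (G : ℕ → ℝ) (t : ℕ) : ℝ := if t = 0 then 0 else G t + tailCost G t

/-- `tailCost` solves the recursion that averages the cost of a fresh start over a uniform rank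
below `t`. -/
lemma sum_startCost (G : ℕ → ℝ) (t : ℕ) :
    ∑ i ∈ Finset.range t, startCost G i = t * tailCost G t := by
  induction t with
  | zero => simp
  | succ t ih =>
    rw [Finset.sum_range_succ, ih]
    rcases Nat.eq_zero_or_pos t with rfl | ht
    · simp [startCost, tailCost]
    · rw [startCost, if_neg ht.ne', tailCost_succ G ht]
      push_cast
      field_simp
      ring

/-- **Potential function bound** for the expected number of queries of `QMax_∞`. -/
theorem expectedQueries_le_of_potential (R : ι → ℝ) {n cq k : ℕ} (hn : Fintype.card ι = n)
    {κ : ℝ} (hκ : (k : ℝ) ≤ κ * cq) (V : ℕ → ℕ → ℝ) (G : ℕ → ℝ)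
    (hV0 : ∀ t u, 1 ≤ t → t < n → 0 ≤ V t u)
    (hV : ∀ t u, 1 ≤ t → t < n →
      cycleCost κ n u + (1 - cycleSuccess n t u) * V t (u + 1) ≤ V t u)
    (hVG : ∀ t, 1 ≤ t → t < n → V t 0 ≤ G t)
    (hG : ∀ t, 1 ≤ t → t + 1 < n → t * G t ≤ ((t : ℝ) + 1) * G (t + 1)) :
    expectedQueries R cq k
      ≤ ENNReal.ofReal ((cq : ℝ) * ∑ t ∈ Finset.Icc 1 (n - 1), G t / ((t : ℝ) + 1)) := by
  classical
  subst hn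
  set n := Fintype.card ι with hn
  have hnpos : 0 < n := Fintype.card_pos
  have hcq : (0 : ℝ) ≤ cq := Nat.cast_nonneg _
  have hG0 : ∀ t, 1 ≤ t → t < n → 0 ≤ G t := fun t h1 h2 => (hV0 t 0 h1 h2).trans (hVG t h1 h2)
  have hT0 : ∀ t, t ≤ n → 0 ≤ tailCost G t := fun t ht =>
    Finset.sum_nonneg fun r hr => by
      rw [Finset.mem_Icc] at hr
      exact div_nonneg (hG0 r hr.1 (by omega)) (by positivity)
  have hmono : MonotoneOn (startCost G) (Set.Iio n) := by
    have hstep : ∀ i, i + 1 < n → startCost G i ≤ startCost G (i + 1) := by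
      intro i hi
      rcases Nat.eq_zero_or_pos i with rfl | hpos
      · simp only [startCost, if_true, if_neg (Nat.succ_ne_zero _)]
        exact add_nonneg (hG0 _ (by omega) hi) (hT0 _ hi.le)
      · rw [startCost, startCost, if_neg hpos.ne', if_neg (Nat.succ_ne_zero _),
          tailCost_succ G hpos]
        have h := hG i hpos hi
        have hi0 : (0 : ℝ) < (i : ℝ) + 1 := by positivity
        -- Monotonicity of `startCost` at `i ≥ 1` is exactly the hypothesis `hG`, divided by `i +
        -- 1`.
        have : G i - G i / ((i : ℝ) + 1) ≤ G (i + 1) := by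
          rw [sub_le_iff_le_add, ← sub_le_iff_le_add', ← sub_nonneg]
          have : G i / ((i : ℝ) + 1) - (G i - G (i + 1))
              = (((i : ℝ) + 1) * G (i + 1) - i * G i) / ((i : ℝ) + 1) := by
            field_simp; ring
          rw [this]
          exact div_nonneg (sub_nonneg.2 h) hi0.le
        linarith
    intro i _ j hj hij
    obtain ⟨d, rfl⟩ := Nat.exists_eq_add_of_le hij
    clear hij
    induction d with
    | zero => exact le_rfl
    | succ d ih =>
      simp only [Set.mem_Iio] at hj ih
      exact (ih (by omega)).trans (hstep (i + d) (by omega))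
  let pot : ℕ → ℕ → ℝ := fun t u => if t = 0 then 0 else V t u + tailCost G t
  have hpot0 : ∀ t u, t < n → 0 ≤ pot t u := by
    intro t u ht
    simp only [pot]
    split_ifs with h
    · exact le_rfl
    · exact add_nonneg (hV0 t u (by omega) ht) (hT0 t ht.le)
  have hpotH : ∀ t, t < n → pot t 0 ≤ startCost G t := by
    intro t ht
    simp only [pot, startCost]
    split_ifs with h
    · exact le_rfl
    · exact add_le_add (hVG t (by omega) ht) le_rfl
  let ψ : Config ι → ℝ := fun s => s.queries + cq * pot (rank R s.threshold) s.failed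
  have hψ0 : ∀ s, 0 ≤ ψ s := fun s =>
    add_nonneg (Nat.cast_nonneg _) (mul_nonneg hcq (hpot0 _ _ (rank_lt R _)))
  have hstep : ∀ s : Config ι,
      ∑' s', step R cq k s s' * ENNReal.ofReal (ψ s') ≤ ENNReal.ofReal (ψ s) := by
    intro s
    obtain ⟨y, u, c⟩ := s
    rw [step]
    split_ifs with hmax
    · exact (tsum_pure_mul _ _).le
    have ht0 : rank R y ≠ 0 := fun h => hmax (rank_eq_zero.1 h)
    set t := rank R y with ht
    have htn : t < n := rank_lt R y
    have htpos : (0 : ℝ) < t := by exact_mod_cast Nat.pos_of_ne_zero ht0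
    rw [tsum_map_mul, tsum_searchCycle_mul _ _ (fun p => ψ _) fun p => hψ0 _]
    refine ENNReal.ofReal_le_ofReal ?_
    set M := ⌈searchRange (Fintype.card ι) u⌉₊ with hM
    have hMpos : 0 < M := Nat.ceil_pos.2 (searchRange_pos Fintype.card_pos u)
    have hMr : (0 : ℝ) < M := by exact_mod_cast hMpos
    set a : ℝ := (t : ℝ) / n with ha
    have ha0 : 0 ≤ a := by positivity
    have hcount : markedCount (marking R y) = t := rfl
    have hterm : ∀ j : ℕ,
        ∑ x, cycleProb (marking R y) j x * ψ (if marking R y x = true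
            then (⟨x, 0, c + (cq * j + k)⟩ : Config ι) else ⟨y, u + 1, c + (cq * j + k)⟩)
          ≤ c + (cq * j + k) + cq * (tailCost G t + (1 - successProb a j) * V t (u + 1)) := by
      intro j
      have h1 : ∀ x, ψ (if marking R y x = true
            then (⟨x, 0, c + (cq * j + k)⟩ : Config ι) else ⟨y, u + 1, c + (cq * j + k)⟩)
          = if marking R y x = true then (c + (cq * j + k)) + cq * pot (rank R x) 0
            else (c + (cq * j + k)) + cq * (V t (u + 1) + tailCost G t) := by
        intro x
        split_ifs
        · simp only [ψ]; push_cast; ring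
        · simp only [ψ, pot, ← ht, if_neg ht0]; push_cast; ring
      simp only [h1]
      rw [sum_cycleProb_mul j (by rw [hcount]; omega), hcount, ← hn, ← ha]
      have hs := successProb_nonneg ha0 j
      have havg : (∑ x with marking R y x = true,
          (((c : ℝ) + (cq * j + k)) + cq * pot (rank R x) 0)) / t
            ≤ (c + (cq * j + k)) + cq * tailCost G t := by
        rw [div_le_iff₀ htpos, Finset.sum_add_distrib, Finset.sum_const, nsmul_eq_mul,
          ← Finset.mul_sum]
        -- Ties enter only here and in the initial average: the actual ranks are compared with `0,
        -- …, t - 1`.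
        have h2 : ∑ x with marking R y x = true, pot (rank R x) 0 ≤ t * tailCost G t := by
          rw [← sum_startCost]
          exact (Finset.sum_le_sum fun x _ => hpotH _ (rank_lt R x)).trans
            (sum_rank_marked_le R hmono y)
        have h3 := mul_le_mul_of_nonneg_left h2 hcq
        have h4 : ((Finset.univ.filter fun x => marking R y x = true).card : ℝ) = t := rfl
        rw [h4]
        linarith
      have := mul_le_mul_of_nonneg_left havg hs
      linarith
    rw [div_le_iff₀ hMr]
    refine (Finset.sum_le_sum fun j _ => hterm j).trans ?_
    have hsumj : ∑ j ∈ Finset.range M, (j : ℝ) = M * ((M : ℝ) - 1) / 2 := by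
      have h := Finset.sum_range_id_mul_two M
      have h' : ((∑ i ∈ Finset.range M, i : ℕ) : ℝ) * 2 = M * ((M - 1 : ℕ) : ℝ) := by
        exact_mod_cast h
      rw [Nat.cast_sub hMpos, Nat.cast_one] at h'
      push_cast at h'
      linarith
    have hsumP : ∑ j ∈ Finset.range M, successProb a j = cycleSuccess n t u * M := by
      rw [cycleSuccess, avgSuccess, ← hM, ← ha]
      exact (div_mul_cancel₀ _ hMr.ne').symm
    have hlin : ∑ j ∈ Finset.range M,
        ((c : ℝ) + (cq * j + k) + cq * (tailCost G t + (1 - successProb a j) * V t (u + 1)))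
        = M * (c + k + cq * tailCost G t + cq * V t (u + 1)) + cq * (M * ((M : ℝ) - 1) / 2)
          - cq * V t (u + 1) * (cycleSuccess n t u * M) := by
      rw [← hsumj, ← hsumP, Finset.mul_sum, Finset.mul_sum]
      have : ∀ b : ℝ, (M : ℝ) * b = ∑ j ∈ Finset.range M, b := by
        intro b; rw [Finset.sum_const, Finset.card_range, nsmul_eq_mul]
      rw [this, ← Finset.sum_add_distrib, ← Finset.sum_sub_distrib]
      exact Finset.sum_congr rfl fun j _ => by ring
    rw [hlin]
    have hrec := hV t u (by omega) htn
    rw [cycleCost, ← hM] at hrec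
    simp only [ψ, pot, ← ht, if_neg ht0]
    have h5 := mul_le_mul_of_nonneg_left hrec (mul_nonneg hcq hMr.le)
    have h6 := mul_le_mul_of_nonneg_right hκ hMr.le
    linarith
  have hlaw : ∀ N, ∑' s, law R cq k N s * ENNReal.ofReal (ψ s)
      ≤ ENNReal.ofReal ((cq : ℝ) * ∑ t ∈ Finset.Icc 1 (n - 1), G t / ((t : ℝ) + 1)) := by
    intro N
    induction N with
    | zero =>
      rw [law, tsum_map_mul, tsum_fintype]
      have hnr : (0 : ℝ) < n := by exact_mod_cast hnpos
      have : ∀ y : ι, PMF.uniformOfFintype ι y * ENNReal.ofReal (ψ ⟨y, 0, 0⟩)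
          = ENNReal.ofReal ((n : ℝ)⁻¹ * (cq * pot (rank R y) 0)) := by
        intro y
        rw [PMF.uniformOfFintype_apply, ENNReal.ofReal_mul (inv_nonneg.2 hnr.le),
          ENNReal.ofReal_inv_of_pos hnr, ENNReal.ofReal_natCast]
        simp [ψ, hn]
      simp only [this]
      rw [← ENNReal.ofReal_sum_of_nonneg fun y _ => mul_nonneg (inv_nonneg.2 hnr.le)
        (mul_nonneg hcq (hpot0 _ _ (rank_lt R y))), ← Finset.mul_sum, ← Finset.mul_sum]
      refine ENNReal.ofReal_le_ofReal ?_
      rw [inv_mul_le_iff₀ hnr, mul_left_comm]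
      refine mul_le_mul_of_nonneg_left ?_ hcq
      have := (Finset.sum_le_sum fun x _ => hpotH _ (rank_lt R x)).trans
        (sum_rank_univ_le R hmono)
      rw [sum_startCost] at this
      exact this
    | succ N ih =>
      rw [law, tsum_bind_mul]
      exact (ENNReal.tsum_le_tsum fun s => mul_le_mul_right (hstep s) _).trans ih
  refine iSup_le fun N => (ENNReal.tsum_le_tsum fun s => ?_).trans (hlaw N)
  refine mul_le_mul_right ?_ _
  rw [← ENNReal.ofReal_natCast]
  exact ENNReal.ofReal_le_ofReal
    (le_add_of_nonneg_right (mul_nonneg hcq (hpot0 _ _ (rank_lt R _))))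

end Search

/-! ### Bounds for the success probability of a cycle -/

lemma successProb_sin_sq (θ : ℝ) (j : ℕ) :
    successProb (Real.sin θ ^ 2) j = Real.sin ((2 * j + 1) * θ) ^ 2 := by
  have key : Real.sin θ * (amplitude (Real.sin θ ^ 2) j).1 = Real.sin ((2 * j + 1) * θ) ∧
      Real.cos θ * (amplitude (Real.sin θ ^ 2) j).2 = Real.cos ((2 * j + 1) * θ) := by
    induction j with
    | zero => simp [amplitude]
    | succ j ih =>
      have harg : (2 * ((j + 1 : ℕ) : ℝ) + 1) * θ = (2 * j + 1) * θ + 2 * θ := by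
        push_cast; ring
      have h1 : Real.cos θ ^ 2 = 1 - Real.sin θ ^ 2 := Real.cos_sq' θ
      rw [harg, Real.sin_add, Real.cos_add, ← ih.1, ← ih.2, Real.sin_two_mul, Real.cos_two_mul, h1]
      simp only [amplitude]
      constructor
      · linear_combination (-2 * (amplitude (Real.sin θ ^ 2) j).2 * Real.sin θ) * h1
      · ring
  rw [successProb, ← key.1]
  ring

/-- The sum telescopes, since `sin (φ + 2θ) - sin (φ - 2θ) = 2 cos φ sin 2θ` with `φ = 2 (2M + 1)θ`.
-/
lemma sum_sin_sq (θ : ℝ) (M : ℕ) :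
    4 * Real.sin (2 * θ) * ∑ j ∈ Finset.range M, Real.sin ((2 * j + 1) * θ) ^ 2
      = 2 * M * Real.sin (2 * θ) - Real.sin (4 * M * θ) := by
  induction M with
  | zero => simp
  | succ M ih =>
    rw [Finset.sum_range_succ, mul_add, ih]
    have h1 : 4 * ((M + 1 : ℕ) : ℝ) * θ = 2 * ((2 * M + 1) * θ) + 2 * θ := by push_cast; ring
    have h2 : 4 * (M : ℝ) * θ = 2 * ((2 * M + 1) * θ) - 2 * θ := by ring
    rw [h1, h2, Real.sin_add, Real.sin_sub, Real.cos_two_mul ((2 * M + 1) * θ), Real.cos_sq']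
    push_cast
    ring

/-- The sine of twice the angle whose squared sine is `a`. -/
def doubleSine (a : ℝ) : ℝ := 2 * Real.sqrt (a * (1 - a))

lemma doubleSine_pos {a : ℝ} (h0 : 0 < a) (h1 : a < 1) : 0 < doubleSine a :=
  mul_pos two_pos (Real.sqrt_pos.2 (mul_pos h0 (sub_pos.2 h1)))

lemma doubleSine_sq {a : ℝ} (h0 : 0 ≤ a) (h1 : a ≤ 1) : doubleSine a ^ 2 = 4 * (a * (1 - a)) := by
  rw [doubleSine, mul_pow, Real.sq_sqrt (mul_nonneg h0 (sub_nonneg.2 h1))]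
  norm_num

lemma exists_angle {a : ℝ} (h0 : 0 < a) (h1 : a < 1) :
    ∃ θ : ℝ, 0 < θ ∧ θ < Real.pi / 2 ∧ Real.sin θ ^ 2 = a ∧ Real.sin (2 * θ) = doubleSine a ∧
      (a ≤ 1 / 2 → θ ≤ Real.pi / 4) ∧ (1 / 2 ≤ a → Real.pi / 4 ≤ θ) ∧
      ∀ M : ℕ, 4 * M * doubleSine a * avgSuccess a M = 2 * M * doubleSine a
        - Real.sin (4 * M * θ) := by
  set θ := Real.arcsin (Real.sqrt a) with hθ
  have hs0 : 0 < Real.sqrt a := Real.sqrt_pos.2 h0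
  have hs1 : Real.sqrt a < 1 := by rw [Real.sqrt_lt' one_pos]; simpa using h1
  have hsin : Real.sin θ = Real.sqrt a := Real.sin_arcsin (by linarith) hs1.le
  have hpos : 0 < θ := Real.arcsin_pos.2 hs0
  have hlt : θ < Real.pi / 2 := Real.arcsin_lt_pi_div_two.2 hs1
  have hsq : Real.sin θ ^ 2 = a := by rw [hsin, Real.sq_sqrt h0.le]
  have hcos : Real.cos θ = Real.sqrt (1 - a) := by
    rw [hθ, Real.cos_arcsin, Real.sq_sqrt h0.le]
  have hcos0 : 0 < Real.cos θ := Real.cos_pos_of_mem_Ioo ⟨by linarith, hlt⟩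
  have hdouble : Real.sin (2 * θ) = doubleSine a := by
    rw [Real.sin_two_mul, hsin, hcos, doubleSine, Real.sqrt_mul h0.le, mul_assoc]
  have hcos2 : Real.cos (2 * θ) = 1 - 2 * a := by
    rw [Real.cos_two_mul, Real.cos_sq', hsq]; ring
  refine ⟨θ, hpos, hlt, hsq, hdouble, ?_, ?_, ?_⟩
  · intro h
    by_contra hcon
    have := Real.cos_neg_of_pi_div_two_lt_of_lt (x := 2 * θ) (by linarith [Real.pi_pos])
      (by linarith [Real.pi_pos])
    linarith
  · intro h
    by_contra hcon
    have := Real.cos_pos_of_mem_Ioo (x := 2 * θ) ⟨by linarith [Real.pi_pos], by linarith⟩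
    linarith
  · intro M
    rcases Nat.eq_zero_or_pos M with rfl | hM
    · simp
    · have hM' : (M : ℝ) ≠ 0 := by exact_mod_cast hM.ne'
      rw [← hdouble, ← sum_sin_sq, avgSuccess, ← hsq]
      rw [Finset.sum_congr rfl fun j _ => successProb_sin_sq θ j]
      field_simp

lemma half_sub_le_avgSuccess {a : ℝ} (h0 : 0 < a) (h1 : a < 1) {M : ℕ} (hM : 1 ≤ M) :
    1 / 2 - 1 / (4 * (M * doubleSine a)) ≤ avgSuccess a M := by
  obtain ⟨θ, -, -, -, -, -, -, h⟩ := exists_angle h0 h1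
  have hs := doubleSine_pos h0 h1
  have hM' : (0 : ℝ) < M := by exact_mod_cast hM
  have hsin := Real.sin_le_one (4 * M * θ)
  rw [show 1 / 2 - 1 / (4 * (M * doubleSine a))
    = (2 * M * doubleSine a - 1) / (4 * M * doubleSine a) by field_simp; ring,
    div_le_iff₀ (by positivity)]
  linarith [h M]

lemma third_le_avgSuccess {a : ℝ} (h0 : 1 / 2 ≤ a) (h1 : a < 1) {M : ℕ} (hM : 3 ≤ M) :
    1 / 3 ≤ avgSuccess a M := by
  obtain ⟨θ, -, hθ, -, hdouble, -, hge, h⟩ := exists_angle (by linarith) h1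
  have hs := doubleSine_pos (by linarith) h1
  have hM' : (3 : ℝ) ≤ M := by exact_mod_cast hM
  have hpi := Real.pi_pos
  set β := Real.pi - 2 * θ with hβ
  have hβ0 : 0 < β := by linarith
  have hβ1 : β ≤ Real.pi / 2 := by linarith [hge h0]
  have hsinβ : Real.sin β = doubleSine a := by rw [hβ, Real.sin_pi_sub, hdouble]
  have hsin : Real.sin (4 * M * θ) = -Real.sin (2 * M * β) := by
    rw [← Real.sin_neg, ← Real.sin_add_nat_mul_two_pi (-(2 * M * β)) M]
    congr 1
    rw [hβ]; ring
  -- If `2Mβ ≤ π` the right side is nonnegative. Otherwise `β > π / (2M)`, and concavity of the sine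
  -- between `0` and `π / 6` gives `2M sin β ≥ 3`.
  suffices hmain : -(2 * M * doubleSine a) ≤ 3 * Real.sin (2 * M * β) by
    have := h M
    rw [hsin] at this
    have hpos : 0 < 12 * (M * doubleSine a) := by positivity
    refine le_of_mul_le_mul_left ?_ hpos
    linarith
  rcases le_or_gt (2 * M * β) Real.pi with hle | hlt
  · have := Real.sin_nonneg_of_nonneg_of_le_pi (by positivity) hle
    have : 0 < 2 * M * doubleSine a := by positivity
    linarith
  · have hge : Real.sin (Real.pi / (2 * M)) ≤ doubleSine a := by
      rw [← hsinβ]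
      have : Real.pi / (2 * M) ≤ β := by
        rw [div_le_iff₀ (by positivity)]; linarith
      have hpos : 0 < Real.pi / (2 * M) := by positivity
      exact Real.sin_le_sin_of_le_of_le_pi_div_two (by linarith) hβ1 this
    have hconc := strictConcaveOn_sin_Icc.concaveOn.2
      (show (0 : ℝ) ∈ Set.Icc 0 Real.pi from ⟨le_rfl, hpi.le⟩)
      (show Real.pi / 6 ∈ Set.Icc 0 Real.pi from ⟨by positivity, by linarith⟩)
      (show (0 : ℝ) ≤ 1 - 3 / M by rw [sub_nonneg, div_le_one (by linarith)]; exact hM')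
      (show (0 : ℝ) ≤ 3 / M by positivity) (by ring)
    simp only [smul_eq_mul, mul_zero, zero_add, Real.sin_zero, Real.sin_pi_div_six] at hconc
    rw [show 3 / (M : ℝ) * (Real.pi / 6) = Real.pi / (2 * M) by field_simp; norm_num] at hconc
    have h3 : 3 / (M : ℝ) * (1 / 2) ≤ doubleSine a := hconc.trans hge
    have h4 : 3 ≤ 2 * M * doubleSine a := by
      rw [div_mul_eq_mul_div, div_le_iff₀ (by linarith)] at h3
      linarith
    linarith [Real.neg_one_le_sin (2 * M * β)]

/-- For `x² ≤ 12`, square the cubic lower bound for `sin (x / 2)` in `cos x = 1 - 2 sin² (x / 2)`;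
beyond that the quartic is at least `1`. -/
lemma cos_le_quartic {x : ℝ} (hx : 0 ≤ x) : Real.cos x ≤ 1 - x ^ 2 / 2 + x ^ 4 / 24 := by
  rcases le_total (x ^ 2) 12 with h | h
  · have h1 := Real.sin_ge_sub_cube (x := x / 2) (by positivity)
    have h2 : 0 ≤ x / 2 - (x / 2) ^ 3 / 6 := by
      have : x / 2 - (x / 2) ^ 3 / 6 = x * (24 - x ^ 2) / 48 := by ring
      rw [this]
      exact div_nonneg (mul_nonneg hx (by linarith)) (by norm_num)
    have h3 := pow_le_pow_left₀ h2 h1 2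
    have h4 : Real.cos x = 1 - 2 * Real.sin (x / 2) ^ 2 := by
      have := Real.cos_two_mul (x / 2)
      rw [Real.cos_sq', mul_div_cancel₀ x two_ne_zero] at this
      linarith
    have h5 : 0 ≤ x ^ 6 := by positivity
    rw [h4]
    linarith
  · have h1 : 0 ≤ x ^ 2 * (x ^ 2 - 12) := mul_nonneg (sq_nonneg x) (by linarith)
    linarith [Real.cos_le_one x]

lemma sin_le_quintic {x : ℝ} (hx : 0 ≤ x) : Real.sin x ≤ x - x ^ 3 / 6 + x ^ 5 / 120 := by
  have hd : ∀ y : ℝ, HasDerivAt (fun y : ℝ => y - y ^ 3 / 6 + y ^ 5 / 120 - Real.sin y)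
      (1 - (3 : ℕ) * y ^ (3 - 1) / 6 + (5 : ℕ) * y ^ (5 - 1) / 120 - Real.cos y) y := fun y =>
    (((hasDerivAt_id' y).fun_sub ((hasDerivAt_pow 3 y).div_const 6)).fun_add
      ((hasDerivAt_pow 5 y).div_const 120)).fun_sub (Real.hasDerivAt_sin y)
  have h : MonotoneOn (fun y : ℝ => y - y ^ 3 / 6 + y ^ 5 / 120 - Real.sin y) (Set.Ici 0) := by
    refine monotoneOn_of_deriv_nonneg (convex_Ici 0)
      (fun y _ => (hd y).continuousAt.continuousWithinAt)
      (fun y _ => (hd y).differentiableAt.differentiableWithinAt) fun y hy => ?_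
    rw [interior_Ici] at hy
    have h1 := cos_le_quartic (Set.mem_Ioi.1 hy).le
    rw [(hd y).deriv]
    norm_num
    linarith
  have := h (Set.mem_Ici.2 le_rfl) (Set.mem_Ici.2 hx) hx
  norm_num at this
  linarith

/-- This replaces `half_sub_le_avgSuccess` below the critical range, where that bound degenerates.
With `y = 4Mθ` and `v = 2M sin 2θ ≤ 2` the claim is `sin y ≤ v - v³ / 8`. -/
lemma sq_div_four_le_avgSuccess {a : ℝ} (h0 : 0 < a) (h1 : a ≤ 1 / 2) {M : ℕ} (hM : 3 ≤ M)
    (hw : M * doubleSine a ≤ 1) : (M * doubleSine a) ^ 2 / 4 ≤ avgSuccess a M := by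
  obtain ⟨θ, hθ0, -, -, hdouble, hle, -, h⟩ := exists_angle h0 (by linarith)
  have hs := doubleSine_pos h0 (by linarith)
  have hM' : (3 : ℝ) ≤ M := by exact_mod_cast hM
  have hpi := Real.pi_pos
  set β := 2 * θ with hβ
  set s := doubleSine a
  have hβ0 : 0 < β := by positivity
  have hβ2 : β ≤ Real.pi / 2 := by linarith [hle h1]
  have hjordan := Real.mul_le_sin hβ0.le hβ2
  have hs3 : s ≤ 1 / 3 := by linarith [mul_le_mul_of_nonneg_right hM' hs.le]
  have hcube := Real.sin_ge_sub_cube hβ0.le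
  rw [hdouble] at hjordan hcube
  -- Bootstrap: Jordan's inequality bounds `β`, the cubic bound for the sine then improves `s / β`,
  -- and a second round gives `0.979`.
  have hβ1 : β ≤ 0.53 := by
    rw [div_mul_eq_mul_div, div_le_iff₀ hpi] at hjordan
    have := mul_le_mul_of_nonneg_right hs3 hpi.le
    linarith [Real.pi_lt_d2]
  have hsq : ∀ b : ℝ, β ≤ b → β ^ 3 ≤ b ^ 2 * β := fun b hb => by
    rw [pow_succ]
    exact mul_le_mul_of_nonneg_right (pow_le_pow_left₀ hβ0.le hb 2) hβ0.le
  have hb : 0.953 * β ≤ s := by linarith [hsq _ hβ1]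
  have hβ3 : β ≤ 0.35 := by linarith
  have hb2 : 0.979 * β ≤ s := by linarith [hsq _ hβ3]
  set y := 2 * M * β with hy
  have hy0 : 0 < y := by positivity
  have hy1 : y ≤ 2.05 := by
    have := mul_le_mul_of_nonneg_left hb2 (by linarith : (0 : ℝ) ≤ M)
    rw [hy]; linarith
  set v := 2 * M * s with hv
  have hv0 : 0 < v := by positivity
  have hsy : s ≤ β := by rw [← hdouble]; exact Real.sin_le hβ0.le
  have hvy : v ≤ y := mul_le_mul_of_nonneg_left hsy (by positivity)
  -- `M ≥ 3` is used here: the relative error `β² / 6 = y² / (24 M²)` is at most `y² / 216`.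
  have hvlow : y - y ^ 3 / 216 ≤ v := by
    have h2 := mul_le_mul_of_nonneg_left hcube (by positivity : (0 : ℝ) ≤ 2 * M)
    have h3 : 2 * M * (β ^ 3 / 6) ≤ y ^ 3 / 216 := by
      have : 0 ≤ M * β ^ 3 * ((M : ℝ) ^ 2 - 9) := by
        have : (0 : ℝ) ≤ (M : ℝ) ^ 2 - 9 := by nlinarith
        positivity
      rw [hy]
      linarith
    rw [mul_sub] at h2
    linarith
  -- The quintic bound suffices because `1/6 - 1/8 - 1/216` exceeds `2.05² / 120`.
  have hsin : Real.sin y ≤ v - v ^ 3 / 8 := by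
    have h5 := sin_le_quintic hy0.le
    have h6 : v ^ 3 ≤ y ^ 3 := pow_le_pow_left₀ hv0.le hvy 3
    have h7 : 0 ≤ y ^ 3 * (4.2025 - y ^ 2) := mul_nonneg (by positivity) (by nlinarith)
    have h8 : 0 ≤ y ^ 3 := by positivity
    linarith
  have h9 := h M
  rw [show 4 * (M : ℝ) * θ = y by rw [hy, hβ]; ring] at h9
  have hpos : 0 < 4 * M * s := by positivity
  refine le_of_mul_le_mul_left ?_ hpos
  rw [h9]
  rw [hv] at hsin
  linarith

lemma avgSuccess_two (a : ℝ) : avgSuccess a 2 = a * (5 - 12 * a + 8 * a ^ 2) := by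
  simp only [avgSuccess, Finset.sum_range_succ, Finset.sum_range_zero, successProb, amplitude]
  push_cast
  ring

/-! ### Numerical evaluation for short lists -/

lemma searchRange_eq {n : ℕ} (hn : 2 ≤ n) (u : ℕ) :
    searchRange n u = min ((6 / 5 : ℝ) ^ (u + 1)) (Real.sqrt n) := by
  have hn' : (2 : ℝ) ≤ n := by exact_mod_cast hn
  induction u with
  | zero =>
    rw [searchRange, zero_add, pow_one, min_eq_left]
    exact Real.le_sqrt_of_sq_le (by norm_num; linarith)
  | succ u ih =>
    rw [searchRange, ih, mul_min_of_nonneg _ _ (by norm_num), min_assoc, ← pow_succ',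
      min_eq_right (a := 6 / 5 * Real.sqrt n)]
    linarith [Real.sqrt_nonneg (n : ℝ)]

/-- The least natural number `m` with `√n ≤ m`, for `n ≥ 1`. -/
def ceilSqrt (n : ℕ) : ℕ := Nat.sqrt (n - 1) + 1

/-- The number of possible numbers of Grover iterations in the cycle after `u` failed ones. -/
def rangeSize (n u : ℕ) : ℕ :=
  min ((6 ^ (u + 1) + 5 ^ (u + 1) - 1) / 5 ^ (u + 1)) (ceilSqrt n)

lemma ceil_sqrt_eq {n : ℕ} (hn : 1 ≤ n) : ⌈Real.sqrt n⌉₊ = ceilSqrt n := by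
  rw [Nat.ceil_eq_iff (by simp [ceilSqrt]), ceilSqrt, Nat.add_sub_cancel]
  constructor
  · apply Real.lt_sqrt_of_sq_lt
    have h := Nat.sqrt_le' (n - 1)
    have : (Nat.sqrt (n - 1)) ^ 2 < n := by omega
    exact_mod_cast this
  · rw [Real.sqrt_le_left (by positivity)]
    have h := Nat.lt_succ_sqrt' (n - 1)
    have : n ≤ (Nat.sqrt (n - 1) + 1) ^ 2 := by
      rw [Nat.succ_eq_add_one] at h; omega
    exact_mod_cast this

lemma ceil_div_eq (a b : ℕ) (hb : 0 < b) : ⌈(a : ℝ) / b⌉₊ = (a + b - 1) / b := by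
  have hb' : (0 : ℝ) < b := by exact_mod_cast hb
  apply le_antisymm
  · rw [Nat.ceil_le, div_le_iff₀ hb']
    have h := Nat.lt_div_mul_add (a := a + b - 1) hb
    have : a ≤ (a + b - 1) / b * b := by omega
    exact_mod_cast this
  · rw [← Nat.lt_succ_iff, Nat.div_lt_iff_lt_mul hb]
    have h : (a : ℝ) ≤ ⌈(a : ℝ) / b⌉₊ * b := (div_le_iff₀ hb').1 (Nat.le_ceil _)
    have h' : a ≤ ⌈(a : ℝ) / b⌉₊ * b := by exact_mod_cast h
    rw [Nat.succ_mul]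
    omega

lemma ceil_searchRange {n : ℕ} (hn : 2 ≤ n) (u : ℕ) : ⌈searchRange n u⌉₊ = rangeSize n u := by
  rw [searchRange_eq hn, Monotone.map_min Nat.ceil_mono, ceil_sqrt_eq (by omega), rangeSize,
    ← ceil_div_eq _ _ (by positivity)]
  congr 3
  push_cast
  rw [div_pow]

lemma rangeSize_pos (n u : ℕ) : 1 ≤ rangeSize n u := by
  refine le_min ?_ (Nat.succ_le_succ (Nat.zero_le _))
  rw [Nat.le_div_iff_mul_le (by positivity)]
  have : 1 ≤ 6 ^ (u + 1) := Nat.one_le_pow _ _ (by norm_num)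
  omega

/-- Since `(6/5)^12 > 8` and `⌈√n⌉ ≤ 9`, the search is stationary after eleven failures, so the
table needs only finitely many entries. -/
lemma rangeSize_eq_ceilSqrt {n u : ℕ} (hn : n ≤ 81) (hu : 11 ≤ u) :
    rangeSize n u = ceilSqrt n := by
  apply min_eq_right
  have h1 : ceilSqrt n ≤ 9 :=
    Nat.succ_le_succ ((Nat.sqrt_le_sqrt (show n - 1 ≤ 80 by omega)).trans (by norm_num))
  refine h1.trans ?_
  rw [← ceil_div_eq _ _ (by positivity)]
  have h2 : ((8 : ℕ) : ℝ) < ((6 ^ (u + 1) : ℕ) : ℝ) / ((5 ^ (u + 1) : ℕ) : ℝ) := by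
    push_cast
    rw [← div_pow]
    calc (8 : ℝ) < (6 / 5) ^ 12 := by norm_num
      _ ≤ (6 / 5) ^ (u + 1) := pow_le_pow_right₀ (by norm_num) (by omega)
  exact Nat.lt_ceil.2 h2

/-- The amplitudes after `j` Grover iterations and the sum of the success probabilities for fewer
iterations, as integers with the denominators `n ^ j` and `n ^ (2 * j - 1)`. -/
def amplitudeInt (n t : ℕ) : ℕ → ℤ × ℤ × ℕ
  | 0 => (1, 1, 0)
  | j + 1 =>
    match amplitudeInt n t j with
    | (d, e, S) => (((n : ℤ) - 2 * t) * d + 2 * (n - t) * e, (n - 2 * t) * e - 2 * t * d,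
        n * n * S + t * (d.natAbs * d.natAbs))

lemma amplitudeInt_spec {n : ℕ} (hn : 0 < n) (t j : ℕ) :
    ((amplitudeInt n t j).1 : ℝ) = n ^ j * (amplitude ((t : ℝ) / n) j).1 ∧
    ((amplitudeInt n t j).2.1 : ℝ) = n ^ j * (amplitude ((t : ℝ) / n) j).2 ∧
    ((amplitudeInt n t j).2.2 : ℝ) * n
      = n ^ (2 * j) * ∑ i ∈ Finset.range j, successProb ((t : ℝ) / n) i := by
  have hn' : (n : ℝ) ≠ 0 := by exact_mod_cast hn.ne'
  induction j with
  | zero => simp [amplitudeInt, amplitude]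
  | succ j ih =>
    obtain ⟨h1, h2, h3⟩ := ih
    have habs : (((amplitudeInt n t j).1.natAbs : ℕ) : ℝ) * ((amplitudeInt n t j).1.natAbs : ℕ)
        = ((amplitudeInt n t j).1 : ℝ) * (amplitudeInt n t j).1 := by
      rw [← Nat.cast_mul, ← Int.cast_natCast, Int.natAbs_mul_self, Int.cast_mul]
    simp only [amplitudeInt, amplitude]
    refine ⟨?_, ?_, ?_⟩
    · push_cast
      rw [h1, h2]
      field_simp
      ring
    · push_cast
      rw [h1, h2]
      field_simp
      ring
    · push_cast
      rw [Finset.sum_range_succ, mul_add, add_mul, habs, h1, successProb,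
        show (n : ℝ) * n * (amplitudeInt n t j).2.2 * n
          = n * n * ((amplitudeInt n t j).2.2 * n) by ring, h3]
      field_simp
      ring

/-- An upper bound, in units of `10⁻⁹`, for the failure probability of a cycle in which the number
of iterations is uniform among the natural numbers smaller than `M`. -/
def failUpper (n t M : ℕ) : ℕ :=
  10 ^ 9 - (amplitudeInt n t M).2.2 * 10 ^ 9 / (M * n ^ (2 * M - 1))

/-- The success probability is an exact fraction of integers; rounding it down rounds the failure
probability up. -/
lemma le_failUpper {n : ℕ} (hn : 0 < n) (t : ℕ) {M : ℕ} (hM : 1 ≤ M) :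
    10 ^ 9 * (1 - avgSuccess ((t : ℝ) / n) M) ≤ failUpper n t M := by
  have hn' : (0 : ℝ) < n := by exact_mod_cast hn
  have hM' : (0 : ℝ) < M := by exact_mod_cast hM
  have h := (amplitudeInt_spec hn t M).2.2
  have hsum : ∑ i ∈ Finset.range M, successProb ((t : ℝ) / n) i
      = (amplitudeInt n t M).2.2 / (n : ℝ) ^ (2 * M - 1) := by
    rw [eq_div_iff (by positivity)]
    apply mul_right_cancel₀ hn'.ne'
    rw [h, mul_assoc, ← pow_succ, show 2 * M - 1 + 1 = 2 * M by omega, mul_comm]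
  have hle : ((((amplitudeInt n t M).2.2 * 10 ^ 9 / (M * n ^ (2 * M - 1)) : ℕ)) : ℝ)
      ≤ 10 ^ 9 * avgSuccess ((t : ℝ) / n) M := by
    refine Nat.cast_div_le.trans (le_of_eq ?_)
    rw [avgSuccess, hsum]
    push_cast
    field_simp
    norm_num
  have hsub : 10 ^ 9 ≤ failUpper n t M
      + (amplitudeInt n t M).2.2 * 10 ^ 9 / (M * n ^ (2 * M - 1)) := by
    rw [failUpper]; omega
  have hsub' : ((10 : ℝ) ^ 9) ≤ failUpper n t M
      + (((amplitudeInt n t M).2.2 * 10 ^ 9 / (M * n ^ (2 * M - 1)) : ℕ) : ℝ) := by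
    exact_mod_cast hsub
  linarith

/-- An upper bound, in units of `10⁻⁹ / 2`, for the expected cost of a search among `t` marked items
after `12 - i` failed cycles, if the check costs `c / 2`. -/
def searchUpper (c n t : ℕ) : ℕ → ℕ
  | 0 => (ceilSqrt n - 1 + c) * 10 ^ 18 / (10 ^ 9 - failUpper n t (ceilSqrt n)) + 1
  | i + 1 => (rangeSize n (11 - i) - 1 + c) * 10 ^ 9
      + failUpper n t (rangeSize n (11 - i)) * searchUpper c n t i / 10 ^ 9 + 1

lemma div_le_natDiv_succ (a b : ℕ) : (a : ℝ) / b ≤ ((a / b + 1 : ℕ) : ℝ) := by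
  rcases Nat.eq_zero_or_pos b with rfl | hb
  · simp
  · rw [div_le_iff₀ (by exact_mod_cast hb)]
    have : a ≤ (a / b + 1) * b := by
      have := Nat.lt_div_mul_add (a := a) hb
      rw [Nat.succ_mul]; omega
    exact_mod_cast this

lemma searchUpper_rec {c n t : ℕ} (hn : 2 ≤ n) (hn' : n ≤ 81)
    (hfail : failUpper n t (ceilSqrt n) < 10 ^ 9) (u : ℕ) :
    cycleCost ((c : ℝ) / 2) n u
        + (1 - cycleSuccess n t u) * ((searchUpper c n t (12 - (u + 1)) : ℕ) / (2 * 10 ^ 9))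
      ≤ (searchUpper c n t (12 - u) : ℕ) / (2 * 10 ^ 9) := by
  have hM := rangeSize_pos n u
  have hM' : ((rangeSize n u - 1 : ℕ) : ℝ) = (rangeSize n u : ℝ) - 1 := by
    rw [Nat.cast_sub hM, Nat.cast_one]
  have hq := le_failUpper (by omega : 0 < n) t hM
  rw [cycleCost, cycleSuccess, ceil_searchRange hn]
  set P := avgSuccess ((t : ℝ) / n) (rangeSize n u)
  rcases lt_or_ge u 12 with hu | hu
  · obtain ⟨i, hi⟩ : ∃ i, 12 - u = i + 1 := ⟨11 - u, by omega⟩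
    have hi' : 12 - (u + 1) = i := by omega
    have hi'' : 11 - i = u := by omega
    rw [hi, hi', searchUpper, hi'']
    have h := div_le_natDiv_succ (failUpper n t (rangeSize n u) * searchUpper c n t i) (10 ^ 9)
    push_cast at h ⊢
    rw [hM']
    have h2 := mul_le_mul_of_nonneg_right hq
      (Nat.cast_nonneg (searchUpper c n t i) : (0 : ℝ) ≤ _)
    rw [div_le_iff₀ (by norm_num)] at h
    rw [le_div_iff₀ (by norm_num), add_mul, mul_assoc (1 - P), div_mul_cancel₀ _ (by norm_num)]
    linarith
  -- Truncated subtraction makes the potential constant from here on; its value is the stationary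
  -- cost of a cycle divided by the success probability, rounded up.
  · rw [show 12 - u = 0 by omega, show 12 - (u + 1) = 0 by omega, searchUpper,
      ← rangeSize_eq_ceilSqrt hn' (by omega : 11 ≤ u)]
    rw [← rangeSize_eq_ceilSqrt hn' (by omega : 11 ≤ u)] at hfail
    have h := div_le_natDiv_succ ((rangeSize n u - 1 + c) * 10 ^ 18)
      (10 ^ 9 - failUpper n t (rangeSize n u))
    set v : ℕ := (rangeSize n u - 1 + c) * 10 ^ 18 / (10 ^ 9 - failUpper n t (rangeSize n u)) + 1
    have hfail' : (failUpper n t (rangeSize n u) : ℝ) < 10 ^ 9 := by exact_mod_cast hfail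
    rw [Nat.cast_sub hfail.le] at h
    push_cast at h ⊢
    rw [hM', div_le_iff₀ (by linarith)] at h
    have h2 := mul_le_mul_of_nonneg_right hq (Nat.cast_nonneg v : (0 : ℝ) ≤ _)
    rw [le_div_iff₀ (by norm_num), add_mul, mul_assoc (1 - P), div_mul_cancel₀ _ (by norm_num)]
    linarith

/-! ### Integer lower bounds for `F` and the cost table -/

/-- A lower bound for the logarithm in the definition of `F`. -/
def logLower (n t : ℕ) : ℕ :=
  ((Finset.range 12).filter fun i => 36 ^ i * (4 * ((n - t) * t)) < 25 ^ i * n ^ 2).card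

/-- A lower bound for `F`, in units of `10⁻⁹ / 2`. -/
def lowerF (n t : ℕ) : ℕ :=
  if 4 * t < n then
    (9 * n * 10 ^ 13) / (2 * (Nat.sqrt ((n - t) * t * 10 ^ 8) + 1))
      + logLower n t * (2 * 10 ^ 9) - 6 * 10 ^ 9
  else 4068800000

lemma four_mul_lt_iff {n t : ℕ} : (t : ℝ) < (n : ℝ) / 4 ↔ 4 * t < n := by
  rw [lt_div_iff₀ (by norm_num)]
  have : (t : ℝ) * 4 = ((4 * t : ℕ) : ℝ) := by push_cast; ring
  rw [this, Nat.cast_lt]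

lemma logb_const_pos : 0 < Real.log (6 / 5) := Real.log_pos (by norm_num)

/-- The argument of the logarithm in the definition of `F`. -/
def criticalRange (n t : ℕ) : ℝ := (n : ℝ) / (2 * Real.sqrt (((n : ℝ) - t) * t))

lemma one_le_criticalRange {n t : ℕ} (ht : 1 ≤ t) (htn : t < n) : 1 ≤ criticalRange n t := by
  have h1 : (1 : ℝ) ≤ t := by exact_mod_cast ht
  have h2 : (t : ℝ) < n := by exact_mod_cast htn
  have hp : 0 < ((n : ℝ) - t) * t := mul_pos (by linarith) (by linarith)
  rw [criticalRange, one_le_div (mul_pos two_pos (Real.sqrt_pos.2 hp)), ← le_div_iff₀' two_pos]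
  refine Real.sqrt_le_iff.2 ⟨by linarith, ?_⟩
  nlinarith [sq_nonneg ((n : ℝ) - 2 * t)]

lemma F_of_lt {n t : ℕ} (h : 4 * t < n) :
    F n t = 9 / 2 * criticalRange n t + ⌈Real.logb (6 / 5) (criticalRange n t)⌉ - 3 := by
  rw [F, if_pos (four_mul_lt_iff.2 h), criticalRange]
  ring

lemma F_of_ge {n t : ℕ} (h : n ≤ 4 * t) : F n t = 2.0344 := by
  rw [F, if_neg]
  rw [four_mul_lt_iff]
  omega

/-- Each counted `i` satisfies `(6/5)^i < criticalRange n t`, an inequality tested after squaring,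
and hence lies below the ceiling. -/
lemma logLower_le {n t : ℕ} (ht : 1 ≤ t) (htn : t < n) :
    (logLower n t : ℝ) ≤ ⌈Real.logb (6 / 5) (criticalRange n t)⌉ := by
  have h1 : (1 : ℝ) ≤ t := by exact_mod_cast ht
  have h2 : (t : ℝ) < n := by exact_mod_cast htn
  have hp : 0 < ((n : ℝ) - t) * t := mul_pos (by linarith) (by linarith)
  have hx := one_le_criticalRange ht htn
  set x := criticalRange n t with hxdef
  set L := ⌈Real.logb (6 / 5) x⌉ with hL
  have hL0 : 0 ≤ L := Int.ceil_nonneg (Real.logb_nonneg (by norm_num) hx)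
  have hcard : logLower n t ≤ L.toNat := by
    rw [logLower, ← Finset.card_range L.toNat]
    refine Finset.card_le_card fun i hi => ?_
    rw [Finset.mem_filter] at hi
    rw [Finset.mem_range, Int.lt_toNat, hL, Int.lt_ceil]
    have hi' : (36 : ℝ) ^ i * (4 * (((n : ℝ) - t) * t)) < 25 ^ i * (n : ℝ) ^ 2 := by
      have := hi.2
      have h3 : (((36 ^ i * (4 * ((n - t) * t)) : ℕ)) : ℝ) < ((25 ^ i * n ^ 2 : ℕ) : ℝ) := by
        exact_mod_cast this
      push_cast [Nat.cast_sub htn.le] at h3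
      exact h3
    have hlt : (6 / 5 : ℝ) ^ i < x := by
      rw [hxdef, criticalRange, lt_div_iff₀ (mul_pos two_pos (Real.sqrt_pos.2 hp))]
      refine lt_of_pow_lt_pow_left₀ 2 (by linarith) ?_
      rw [mul_pow, mul_pow, Real.sq_sqrt hp.le, ← pow_mul, mul_comm i 2, pow_mul, div_pow]
      rw [show ((6 : ℝ) ^ 2 / 5 ^ 2) = 36 / 25 by norm_num, div_pow, div_mul_eq_mul_div,
        div_lt_iff₀ (by positivity)]
      linarith
    rw [show ((i : ℤ) : ℝ) = (i : ℝ) by simp, Real.lt_logb_iff_rpow_lt (by norm_num) (by linarith),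
      Real.rpow_natCast]
    exact hlt
  have : ((logLower n t : ℕ) : ℤ) ≤ L := by omega
  exact_mod_cast this

lemma F_nonneg {n t : ℕ} (ht : 1 ≤ t) (htn : t < n) : 0 ≤ F n t := by
  rcases lt_or_ge (4 * t) n with h | h
  · rw [F_of_lt h]
    have hx := one_le_criticalRange ht htn
    have : (0 : ℝ) ≤ ⌈Real.logb (6 / 5) (criticalRange n t)⌉ := by
      exact_mod_cast Int.ceil_nonneg (Real.logb_nonneg (by norm_num) hx)
    linarith
  · rw [F_of_ge h]; norm_num

lemma lowerF_le {n t : ℕ} (ht : 1 ≤ t) (htn : t < n) : (lowerF n t : ℝ) / (2 * 10 ^ 9) ≤ F n t := by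
  rw [lowerF]
  split_ifs with h
  · rcases le_total ((9 * n * 10 ^ 13) / (2 * (Nat.sqrt ((n - t) * t * 10 ^ 8) + 1))
      + logLower n t * (2 * 10 ^ 9)) (6 * 10 ^ 9) with h0 | h0
    · rw [Nat.sub_eq_zero_of_le h0]
      simpa using F_nonneg ht htn
    · rw [Nat.cast_sub h0, F_of_lt h, div_le_iff₀ (by norm_num)]
      have h1 : (1 : ℝ) ≤ t := by exact_mod_cast ht
      have h2 : (t : ℝ) < n := by exact_mod_cast htn
      have hp : 0 < ((n : ℝ) - t) * t := mul_pos (by linarith) (by linarith)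
      have hs : 0 < Real.sqrt (((n : ℝ) - t) * t) := Real.sqrt_pos.2 hp
      have hsq : Real.sqrt (((n : ℝ) - t) * t) * 10 ^ 4
          ≤ ((Nat.sqrt ((n - t) * t * 10 ^ 8) + 1 : ℕ) : ℝ) := by
        refine le_of_sq_le_sq ?_ (by positivity)
        rw [mul_pow, Real.sq_sqrt hp.le]
        have h3 := (Nat.lt_succ_sqrt' ((n - t) * t * 10 ^ 8)).le
        have h4 : (((n - t) * t * 10 ^ 8 : ℕ) : ℝ)
            ≤ ((Nat.sqrt ((n - t) * t * 10 ^ 8) + 1) ^ 2 : ℕ) := by exact_mod_cast h3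
        push_cast [Nat.cast_sub htn.le] at h4 ⊢
        linarith
      have hdiv : (((9 * n * 10 ^ 13) / (2 * (Nat.sqrt ((n - t) * t * 10 ^ 8) + 1)) : ℕ) : ℝ)
          ≤ 9 / 2 * criticalRange n t * (2 * 10 ^ 9) := by
        refine Nat.cast_div_le.trans ?_
        rw [criticalRange]
        push_cast at hsq ⊢
        have hn0 : (0 : ℝ) ≤ n := Nat.cast_nonneg n
        rw [show 9 / 2 * ((n : ℝ) / (2 * Real.sqrt (((n : ℝ) - t) * t))) * (2 * 10 ^ 9)
          = 9 * n * 10 ^ 13 / (2 * (Real.sqrt (((n : ℝ) - t) * t) * 10 ^ 4)) by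
            field_simp]
        gcongr
        norm_num
      have hlog := logLower_le ht htn
      push_cast at hdiv hlog ⊢
      linarith
  · rw [F_of_ge (by omega)]; norm_num

/-- The maximum over `r ≤ t` of `r` times the bound for the search among `r` items, an upper bound
for the expected cost of all searches among at most `t` items, and a lower bound for the
corresponding sum of values of `F`, in units of `10⁻⁹ / 2`. -/
def costTable (c n : ℕ) : ℕ → ℕ × ℕ × ℕ
  | 0 => (0, 0, 0)
  | t + 1 =>
    match costTable c n t with
    | (W, A, B) =>
      (max W ((t + 1) * searchUpper c n (t + 1) 12),
        A + max W ((t + 1) * searchUpper c n (t + 1) 12) / ((t + 1) * (t + 2)) + 1,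
        B + lowerF n (t + 1) / (t + 2))

lemma costTable_upper (c n t : ℕ) :
    ∑ r ∈ Finset.Icc 1 t, ((costTable c n r).1 / (2 * 10 ^ 9) / r : ℝ) / ((r : ℝ) + 1)
      ≤ (costTable c n t).2.1 / (2 * 10 ^ 9) := by
  induction t with
  | zero => simp [costTable]
  | succ t ih =>
    rw [Finset.sum_Icc_succ_top (by omega)]
    have h := div_le_natDiv_succ (costTable c n (t + 1)).1 ((t + 1) * (t + 2))
    have h2 : ((costTable c n (t + 1)).2.1 : ℝ) = (costTable c n t).2.1
        + (((costTable c n (t + 1)).1 / ((t + 1) * (t + 2)) + 1 : ℕ) : ℝ) := by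
      simp only [costTable]; push_cast; ring
    rw [h2, add_div]
    refine add_le_add ih ?_
    rw [le_div_iff₀ (by norm_num)]
    refine le_trans (le_of_eq ?_) h
    push_cast
    field_simp
    ring

lemma costTable_lower {c n t : ℕ} (ht : t < n) :
    ((costTable c n t).2.2 : ℝ) / (2 * 10 ^ 9) ≤ ∑ r ∈ Finset.Icc 1 t, F n r / ((r : ℝ) + 1) := by
  induction t with
  | zero => simp [costTable]
  | succ t ih =>
    rw [Finset.sum_Icc_succ_top (by omega)]
    have h2 : ((costTable c n (t + 1)).2.2 : ℝ) = (costTable c n t).2.2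
        + ((lowerF n (t + 1) / (t + 2) : ℕ) : ℝ) := by
      simp only [costTable]; push_cast; ring
    rw [h2, add_div]
    refine add_le_add (ih (by omega)) ?_
    have h3 : ((lowerF n (t + 1) / (t + 2) : ℕ) : ℝ) ≤ _ := Nat.cast_div_le
    have h4 := lowerF_le (n := n) (t := t + 1) (by omega) ht
    refine (div_le_div_of_nonneg_right h3 (by norm_num)).trans ?_
    rw [div_right_comm]
    push_cast
    rw [show (t : ℝ) + 1 + 1 = t + 2 by ring]
    exact div_le_div_of_nonneg_right h4 (by positivity)

lemma le_costTable {c n t : ℕ} (ht : 1 ≤ t) :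
    t * searchUpper c n t 12 ≤ (costTable c n t).1 := by
  obtain ⟨m, rfl⟩ : ∃ m, t = m + 1 := ⟨t - 1, by omega⟩
  exact le_max_right _ _

lemma costTable_mono (c n t : ℕ) : (costTable c n t).1 ≤ (costTable c n (t + 1)).1 :=
  le_max_left _ _

theorem expectedQueries_le_costTable {ι : Type*} [Fintype ι] [Nonempty ι] (R : ι → ℝ)
    {n cq k c : ℕ} (hn : Fintype.card ι = n) (hn2 : 2 ≤ n) (hn81 : n ≤ 81)
    (hκ : 2 * k ≤ c * cq)
    (hfail : ∀ t < n, 1 ≤ t → failUpper n t (ceilSqrt n) < 10 ^ 9) :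
    expectedQueries R cq k
      ≤ ENNReal.ofReal ((cq : ℝ) * ((costTable c n (n - 1)).2.1 / (2 * 10 ^ 9))) := by
  have hκ' : (k : ℝ) ≤ (c : ℝ) / 2 * cq := by
    have : (2 : ℝ) * k ≤ c * cq := by exact_mod_cast hκ
    linarith
  refine (expectedQueries_le_of_potential R hn hκ'
    (fun t u => (searchUpper c n t (12 - u) : ℕ) / (2 * 10 ^ 9))
    -- Using the running maximum of `r` times the search bound makes `t * G t` nondecreasing by
    -- construction.
    (fun t => (costTable c n t).1 / (2 * 10 ^ 9) / t) ?_ ?_ ?_ ?_).trans ?_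
  · intros; positivity
  · intro t u ht htn
    exact searchUpper_rec hn2 hn81 (hfail t htn ht) u
  · intro t ht _
    have ht' : (0 : ℝ) < t := by exact_mod_cast ht
    rw [le_div_iff₀ ht', div_mul_eq_mul_div]
    refine div_le_div_of_nonneg_right ?_ (by norm_num)
    have := le_costTable (c := c) (n := n) ht
    rw [mul_comm]
    exact_mod_cast this
  · intro t ht _
    have ht' : (0 : ℝ) < t := by exact_mod_cast ht
    push_cast
    rw [mul_div_cancel₀ _ ht'.ne', mul_div_cancel₀ _ (by positivity)]
    refine div_le_div_of_nonneg_right ?_ (by norm_num)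
    exact_mod_cast costTable_mono c n t
  · refine ENNReal.ofReal_le_ofReal (mul_le_mul_of_nonneg_left (costTable_upper c n (n - 1))
      (Nat.cast_nonneg _))

/-! ### Potential functions for the search -/

lemma abs_log_const : |Real.log (6 / 5) - 0.18232| ≤ 0.00001 := by
  have h := Real.abs_log_sub_add_sum_range_le (x := 1 / 6) (by norm_num [abs_lt]) 6
  have h2 : Real.log (1 - 1 / 6) = -Real.log (6 / 5) := by
    rw [← Real.log_inv]; norm_num
  rw [h2] at h
  norm_num [Finset.sum_range_succ, abs_le] at h ⊢
  constructor <;> linarith [h.1, h.2]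

lemma log_const_lt : Real.log (6 / 5) < 0.18233 + 0.000001 := by
  linarith [(abs_le.1 abs_log_const).2]

lemma log_const_gt : 0.1823 < Real.log (6 / 5) := by
  linarith [(abs_le.1 abs_log_const).1]

/-- Here `-log v ≥ 1 - v ≥ (1 - v²) / 2`, and `2.74 * log (6/5) ≤ 1/2`. -/
lemma le_logb_inv {v : ℝ} (h0 : 0 < v) (h1 : v ≤ 1) :
    2.74 * (1 - v ^ 2) ≤ Real.logb (6 / 5) (1 / v) := by
  have hL := logb_const_pos
  have hlog := Real.log_le_sub_one_of_pos h0
  rw [Real.logb, le_div_iff₀ hL, one_div, Real.log_inv]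
  have h2 : 0 ≤ 1 - v ^ 2 := by nlinarith
  have h3 := mul_le_mul_of_nonneg_left log_const_lt.le h2
  nlinarith [sq_nonneg (1 - v)]

/-- A bound for the expected remaining cost of the search when the current range is `x` and few
items are marked. -/
def fewPotential (s x : ℝ) : ℝ :=
  if 1 ≤ x * s then 1.25 * x + 1.5 / s + 4
  else 3.75 / s - 2.5 * x + 1.52 * x ^ 2 * s + Real.logb (6 / 5) (1 / (x * s)) + 1.85
    + 2.4 * (x * s) ^ 2

lemma fewPotential_nonneg {s x : ℝ} (hs : 0 < s) (hx : 0 < x) : 0 ≤ fewPotential s x := by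
  rw [fewPotential]
  split_ifs with h
  · positivity
  · have hw : 0 < x * s := mul_pos hx hs
    have h1 := le_logb_inv hw (not_le.1 h).le
    have h2 : 0 ≤ 1 - (x * s) ^ 2 := by nlinarith [not_le.1 h]
    have h3 : 3.75 / s - 2.5 * x + 1.52 * x ^ 2 * s
        = (3.75 - 2.5 * (x * s) + 1.52 * (x * s) ^ 2) / s := by
      field_simp
    have h4 : 0 ≤ (3.75 - 2.5 * (x * s) + 1.52 * (x * s) ^ 2) / s :=
      div_nonneg (by nlinarith [sq_nonneg (x * s - 1)]) hs.le
    rw [h3]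
    nlinarith [sq_nonneg (x * s)]

/-- Below the critical range `1 / s`, passing from `x` to `6x/5` releases `x / 2` through the term
`-2.5 x` and `1` through the logarithm, which pays for the iterations and the check. The two
quadratic terms record the success probability `(x s)² / 4`. -/
lemma fewPotential_step {s x P : ℝ} (hs : 0 < s) (hx : 0 < x)
    (hP1 : 1 ≤ x * s → 1 / 2 - 1 / (4 * (x * s)) ≤ P)
    (hP2 : x * s < 1 → (x * s) ^ 2 / 4 ≤ P) :
    x / 2 + 1 + (1 - P) * fewPotential s (6 / 5 * x) ≤ fewPotential s x := by
  have hW := fewPotential_nonneg hs (show 0 < 6 / 5 * x by positivity)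
  obtain ⟨z, hz0, hz⟩ : ∃ z : ℝ, 0 < z ∧ s = 1 / z := ⟨1 / s, by positivity, by simp⟩
  obtain ⟨w, hw0, hw⟩ : ∃ w : ℝ, 0 < w ∧ x = w * z :=
    ⟨x * s, mul_pos hx hs, by rw [hz]; field_simp⟩
  have hws : x * s = w := by rw [hw, hz]; field_simp
  have hws' : 6 / 5 * x * s = 6 / 5 * w := by rw [← hws]; ring
  rw [hws] at hP1 hP2
  rcases le_or_gt 1 w with h1 | h1
  · have e1 : fewPotential s (6 / 5 * x) = 1.5 * (w * z) + 1.5 * z + 4 := by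
      rw [fewPotential, hws', if_pos (by linarith), hw, hz, div_div_eq_mul_div, div_one]; ring
    have e2 : fewPotential s x = 1.25 * (w * z) + 1.5 * z + 4 := by
      rw [fewPotential, hws, if_pos h1, hw, hz, div_div_eq_mul_div, div_one]
    rw [e1] at hW
    rw [e1, e2, hw]
    have h2 := mul_le_mul_of_nonneg_right (hP1 h1) hW
    have h3 : (1 / 2 - 1 / (4 * w)) * (1.5 * (w * z) + 1.5 * z + 4)
        = 0.75 * (w * z) + 0.375 * z + 2 - (0.375 * z + 1) * (1 / w) := by
      field_simp; ring
    have h4 : (0.375 * z + 1) * (1 / w) ≤ 0.375 * z + 1 :=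
      mul_le_of_le_one_right (by positivity) (by rw [div_le_one hw0]; exact h1)
    linarith
  · have hP := hP2 h1
    have e2 : fewPotential s x = z * (3.75 - 2.5 * w + 1.52 * w ^ 2) + Real.logb (6 / 5) (1 / w)
        + 1.85 + 2.4 * w ^ 2 := by
      rw [fewPotential, hws, if_neg (not_le.2 h1), hw, hz, div_div_eq_mul_div, div_one]
      field_simp
    have h2 := mul_le_mul_of_nonneg_right hP hW
    have hlogw := le_logb_inv hw0 h1.le
    rw [e2]
    rcases le_or_gt 1 (6 / 5 * w) with h3 | h3
    · have e1 : fewPotential s (6 / 5 * x) = 1.5 * (w * z) + 1.5 * z + 4 := by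
        rw [fewPotential, hws', if_pos h3, hw, hz, div_div_eq_mul_div, div_one]; ring
      rw [e1] at h2 ⊢
      rw [hw]
      -- The cycle that crosses the critical range: this is what remains of the coefficient of `z =
      -- 1 / s`. The cubic is smallest near `w = 0.92`, with little room.
      have h4 : 0 ≤ z * (2.25 - 4.5 * w + 1.895 * w ^ 2 + 0.375 * w ^ 3) := by
        refine mul_nonneg hz0.le ?_
        nlinarith [sq_nonneg (w - 0.92), mul_nonneg hw0.le (sq_nonneg (w - 0.92))]
      nlinarith [mul_nonneg (sub_nonneg.2 h3) hw0.le]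
    · have hlog : Real.logb (6 / 5) (1 / (6 / 5 * w)) = Real.logb (6 / 5) (1 / w) - 1 := by
        have : (1 / (6 / 5 * w)) = (1 / w) / (6 / 5) := by field_simp
        rw [this, Real.logb_div (by positivity) (by norm_num), Real.logb_self_eq_one (by norm_num)]
      have hlog2 := le_logb_inv (show 0 < 6 / 5 * w by positivity) h3.le
      rw [hlog] at hlog2
      have e1 : fewPotential s (6 / 5 * x)
          = z * (3.75 - 3 * w + 2.1888 * w ^ 2) + (Real.logb (6 / 5) (1 / w) - 1) + 1.85
            + 3.456 * w ^ 2 := by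
        rw [fewPotential, hws', if_neg (not_le.2 h3), hlog, hw, hz, div_div_eq_mul_div, div_one]
        field_simp
        ring
      rw [e1] at h2 ⊢
      rw [hw]
      set Λ := Real.logb (6 / 5) (1 / w)
      -- `h4` and `h5` are four times the surplus of success probability times remaining cost over
      -- the growth of the quadratic terms: `1.0748 = 3.75 - 4 * 0.6688` and `4.224 = 4 * 1.056`.
      have h4 : 0 ≤ z * w ^ 2 * (1.0748 - 3 * w + 2.1888 * w ^ 2) := by
        refine mul_nonneg (by positivity) ?_
        nlinarith [sq_nonneg (w - 0.6853)]
      have h5 : 0 ≤ w ^ 2 * (Λ - 1 + 1.85 + 3.456 * w ^ 2 - 4.224) := by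
        refine mul_nonneg (by positivity) ?_
        nlinarith
      nlinarith

lemma fewPotential_mono {s x y : ℝ} (hx : 1 ≤ x * s) (hs : 0 < s) (hxy : x ≤ y) :
    fewPotential s x ≤ fewPotential s y := by
  have hy : 1 ≤ y * s := hx.trans (mul_le_mul_of_nonneg_right hxy hs.le)
  rw [fewPotential, fewPotential, if_pos hx, if_pos hy]
  linarith

/-- A bound for the expected remaining cost of the search for `t` marked items among `n` when the
current range is `x`. -/
def rangePotential (n t : ℕ) (x : ℝ) : ℝ :=
  if n < 2 * t then 2.5 * x + 3
  else if n ≤ 17 * t then 1.25 * x + 7.4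
  else fewPotential (doubleSine ((t : ℝ) / n)) x

lemma ratio_bounds {n t : ℕ} (ht : 1 ≤ t) (htn : t < n) :
    0 < (t : ℝ) / n ∧ (t : ℝ) / n < 1 := by
  have h1 : (0 : ℝ) < t := by exact_mod_cast ht
  have h2 : (t : ℝ) < n := by exact_mod_cast htn
  exact ⟨div_pos h1 (h1.trans h2), (div_lt_one (h1.trans h2)).2 h2⟩

lemma rangePotential_nonneg {n t : ℕ} (ht : 1 ≤ t) (htn : t < n) {x : ℝ} (hx : 0 < x) :
    0 ≤ rangePotential n t x := by
  obtain ⟨h0, h1⟩ := ratio_bounds ht htn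
  rw [rangePotential]
  split_ifs
  · positivity
  · positivity
  · exact fewPotential_nonneg (doubleSine_pos h0 h1) hx

lemma rangePotential_step {n t : ℕ} (ht : 1 ≤ t) (htn : t < n) {x : ℝ} (hx : 2.0736 ≤ x) {M : ℕ}
    (hM : 3 ≤ M) (hxM : x ≤ M) :
    x / 2 + 1 + (1 - avgSuccess ((t : ℝ) / n) M) * rangePotential n t (6 / 5 * x)
      ≤ rangePotential n t x := by
  obtain ⟨h0, h1⟩ := ratio_bounds ht htn
  have hn : (0 : ℝ) < n := by exact_mod_cast (by omega : 0 < n)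
  have hs := doubleSine_pos h0 h1
  have hx0 : 0 < x := by linarith
  have hhalf := half_sub_le_avgSuccess h0 h1 (by omega : 1 ≤ M)
  have hsq := doubleSine_sq h0.le h1.le
  set a := (t : ℝ) / n with ha
  set s := doubleSine a with hsdef
  have hxs : x * s ≤ M * s := mul_le_mul_of_nonneg_right hxM hs.le
  have hxs0 : 0 < x * s := mul_pos hx0 hs
  have hhalf' : 1 / 2 - 1 / (4 * (x * s)) ≤ avgSuccess a M := by
    refine le_trans (sub_le_sub_left ?_ _) hhalf
    exact one_div_le_one_div_of_le (by positivity) (by linarith)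
  simp only [rangePotential]
  split_ifs with hc1 hc2
  · have hP := third_le_avgSuccess (a := a) (by
      rw [ha, le_div_iff₀ hn]
      have : (n : ℝ) < 2 * t := by exact_mod_cast hc1
      linarith) h1 hM
    have := mul_le_mul_of_nonneg_right hP (show 0 ≤ 2.5 * (6 / 5 * x) + 3 by positivity)
    linarith
  · have ha1 : 1 / 17 ≤ a := by
      rw [ha, le_div_iff₀ hn]
      have : (n : ℝ) ≤ 17 * t := by exact_mod_cast hc2
      linarith
    have ha2 : a ≤ 1 / 2 := by
      rw [ha, div_le_iff₀ hn]
      have : (2 : ℝ) * t ≤ n := by exact_mod_cast not_lt.1 hc1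
      linarith
    have hs8 : 8 / 17 ≤ s := by
      -- `8 / 17` is the value of `doubleSine` at `1 / 17`, its least value on the interval from `1
      -- / 17` to `1 / 2`.
      refine le_of_sq_le_sq ?_ hs.le
      rw [hsq]
      nlinarith
    have hK : 0 ≤ 1.25 * (6 / 5 * x) + 7.4 := by positivity
    have h2 := mul_le_mul_of_nonneg_right hhalf' hK
    have h3 : (1 / 2 - 1 / (4 * (x * s))) * (1.25 * (6 / 5 * x) + 7.4)
        = 0.75 * x + 3.7 - (0.375 + 1.85 * (1 / x)) * (1 / s) := by
      field_simp; ring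
    have h4 : 1 / x ≤ 1 / 2.0736 := one_div_le_one_div_of_le (by norm_num) hx
    have h5 : 1 / s ≤ 1 / (8 / 17) := one_div_le_one_div_of_le (by norm_num) hs8
    have h6 : (0.375 + 1.85 * (1 / x)) * (1 / s)
        ≤ (0.375 + 1.85 * (1 / 2.0736)) * (1 / (8 / 17)) :=
      mul_le_mul (by linarith) h5 (by positivity) (by norm_num)
    norm_num at h6 h3 h2 ⊢
    linarith
  · refine fewPotential_step hs hx0 (fun _ => hhalf') fun hlt => ?_
    have ha2 : a ≤ 1 / 2 := by
      rw [ha, div_le_iff₀ hn]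
      have : (2 : ℝ) * t ≤ n := by exact_mod_cast not_lt.1 hc1
      linarith
    rcases le_or_gt (M * s) 1 with hle | hgt
    · refine le_trans ?_ (sq_div_four_le_avgSuccess h0 ha2 hM hle)
      have := pow_le_pow_left₀ hxs0.le hxs 2
      linarith
    · have h3 : 1 / (4 * (M * s)) ≤ 1 / (4 * 1) :=
        one_div_le_one_div_of_le (by norm_num) (by linarith)
      have h4 : (x * s) ^ 2 ≤ 1 := pow_le_one₀ hxs0.le hlt.le
      linarith

/-- Needed for the cap on `m`. Where few items are marked, `√n` is beyond the critical range because
`4t (1 - t / n) ≥ 1`, so the increasing branch applies. -/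
lemma rangePotential_mono {n t : ℕ} (ht : 1 ≤ t) (htn : t < n) {x : ℝ} (hx : Real.sqrt n ≤ x) :
    rangePotential n t (Real.sqrt n) ≤ rangePotential n t x := by
  obtain ⟨h0, h1⟩ := ratio_bounds ht htn
  have hn : (0 : ℝ) < n := by exact_mod_cast (by omega : 0 < n)
  simp only [rangePotential]
  split_ifs with hc1 hc2
  · linarith
  · linarith
  · refine fewPotential_mono ?_ (doubleSine_pos h0 h1) hx
    have hs := doubleSine_pos h0 h1
    have hsq := doubleSine_sq h0.le h1.le
    rw [← one_le_sq_iff₀ (by positivity), mul_pow, Real.sq_sqrt hn.le, hsq]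
    have h3 : (n : ℝ) * (4 * ((t : ℝ) / n * (1 - (t : ℝ) / n))) = 4 * t * (1 - (t : ℝ) / n) := by
      field_simp
    have h4 : (t : ℝ) / n ≤ 1 / 2 := by
      rw [div_le_iff₀ hn]
      have : (2 : ℝ) * t ≤ n := by exact_mod_cast not_lt.1 hc1
      linarith
    have h5 : (1 : ℝ) ≤ t := by exact_mod_cast ht
    rw [h3]
    nlinarith

lemma avgSuccess_le_one {a : ℝ} (h1 : a ≤ 1) (M : ℕ) : avgSuccess a M ≤ 1 := by
  rw [avgSuccess]
  refine div_le_one_of_le₀ ?_ (Nat.cast_nonneg _)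
  have : ∀ j ∈ Finset.range M, successProb a j ≤ 1 := fun j _ => by
    have h2 := amplitude_normSq a j
    have h3 : 0 ≤ (1 - a) * (amplitude a j).2 ^ 2 :=
      mul_nonneg (sub_nonneg.2 h1) (sq_nonneg _)
    rw [successProb]
    linarith
  simpa using Finset.sum_le_card_nsmul _ _ _ this

/-- The failure probability of a cycle with at most one iteration. -/
def firstFailure (n t : ℕ) : ℝ := 1 - avgSuccess ((t : ℝ) / n) 2

/-- A bound for the expected remaining cost of the search after `u` failed cycles. -/
def searchPotential (n t u : ℕ) : ℝ :=
  if 3 ≤ u then rangePotential n t (searchRange n u)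
  else 1.5 * ∑ i ∈ Finset.range (3 - u), firstFailure n t ^ i
    + firstFailure n t ^ (3 - u) * rangePotential n t 2.0736

section

variable {n t : ℕ}

lemma firstFailure_nonneg (ht : 1 ≤ t) (htn : t < n) : 0 ≤ firstFailure n t := by
  obtain ⟨h0, h1⟩ := ratio_bounds ht htn
  exact sub_nonneg.2 (avgSuccess_le_one h1.le 2)

lemma sqrt_ge_of_ge {n : ℕ} (hn : 5 ≤ n) : 2.0736 ≤ Real.sqrt n := by
  refine Real.le_sqrt_of_sq_le ?_
  have : (5 : ℝ) ≤ n := by exact_mod_cast hn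
  norm_num
  linarith

lemma searchRange_ge (hn : 5 ≤ n) {u : ℕ} (hu : 3 ≤ u) : 2.0736 ≤ searchRange n u := by
  rw [searchRange_eq (by omega)]
  refine le_min ?_ (sqrt_ge_of_ge hn)
  calc (2.0736 : ℝ) = (6 / 5) ^ 4 := by norm_num
    _ ≤ (6 / 5) ^ (u + 1) := pow_le_pow_right₀ (by norm_num) (by omega)

lemma searchRange_three (hn : 5 ≤ n) : searchRange n 3 = 2.0736 := by
  rw [searchRange_eq (by omega), min_eq_left]
  · norm_num
  · have := sqrt_ge_of_ge hn
    norm_num at this ⊢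
    linarith

lemma rangeSize_of_lt_three (hn : 5 ≤ n) {u : ℕ} (hu : u < 3) : rangeSize n u = 2 := by
  have h : 2 ≤ ceilSqrt n :=
    Nat.succ_le_succ (Nat.le_sqrt.2 (by omega))
  rw [rangeSize]
  interval_cases u <;> norm_num <;> omega

lemma searchPotential_nonneg (hn : 5 ≤ n) (ht : 1 ≤ t) (htn : t < n) (u : ℕ) :
    0 ≤ searchPotential n t u := by
  have hq := firstFailure_nonneg ht htn
  rw [searchPotential]
  split_ifs with h
  · exact rangePotential_nonneg ht htn (by linarith [searchRange_ge hn h])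
  · have := rangePotential_nonneg ht htn (x := 2.0736) (by norm_num)
    have h2 : 0 ≤ ∑ i ∈ Finset.range (3 - u), firstFailure n t ^ i :=
      Finset.sum_nonneg fun i _ => pow_nonneg hq i
    positivity

/-- The first three cycles choose from two values of `j` and cost `1.5` each, so equality holds
there. Later, `⌈x⌉ - 1 < x` lets the step inequality in the real range `x` apply. -/
lemma searchPotential_step (hn : 5 ≤ n) (ht : 1 ≤ t) (htn : t < n) (u : ℕ) :
    cycleCost 1 n u + (1 - cycleSuccess n t u) * searchPotential n t (u + 1)
      ≤ searchPotential n t u := by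
  obtain ⟨h0, h1⟩ := ratio_bounds ht htn
  rcases lt_or_ge u 3 with hu | hu
  · have hM : ⌈searchRange n u⌉₊ = 2 := by
      rw [ceil_searchRange (by omega), rangeSize_of_lt_three hn hu]
    rw [cycleCost, cycleSuccess, hM]
    change _ + firstFailure n t * _ ≤ _
    rw [searchPotential, searchPotential, if_neg (show ¬ 3 ≤ u by omega)]
    apply le_of_eq
    interval_cases u
    · norm_num [Finset.sum_range_succ]; ring
    · norm_num [Finset.sum_range_succ]; ring
    · norm_num [searchRange_three hn]
  · rw [searchPotential, searchPotential, if_pos hu, if_pos (show 3 ≤ u + 1 by omega)]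
    have hx := searchRange_ge hn hu
    have hM : 3 ≤ ⌈searchRange n u⌉₊ := by
      have : (2 : ℕ) < ⌈searchRange n u⌉₊ := Nat.lt_ceil.2 (by norm_num; linarith)
      omega
    have hstep := rangePotential_step ht htn hx hM (Nat.le_ceil _)
    have hceil := Nat.ceil_lt_add_one (show 0 ≤ searchRange n u by linarith)
    have hnext : rangePotential n t (searchRange n (u + 1))
        ≤ rangePotential n t (6 / 5 * searchRange n u) := by
      rw [searchRange]
      rcases le_total (6 / 5 * searchRange n u) (Real.sqrt n) with h | h
      · rw [min_eq_left h]
      · rw [min_eq_right h]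
        exact rangePotential_mono ht htn h
    rw [cycleCost, cycleSuccess]
    have h2 := mul_le_mul_of_nonneg_left hnext
      (sub_nonneg.2 (avgSuccess_le_one h1.le ⌈searchRange n u⌉₊))
    linarith

end

/-! ### Kernel verification for lists of fewer than 80 items -/

set_option maxRecDepth 100000 in
lemma failUpper_lt : ∀ n < 80, 2 ≤ n → ∀ t < n, 1 ≤ t → failUpper n t (ceilSqrt n) < 10 ^ 9 := by
  decide +kernel

-- In units of `10⁻⁹ / 2` the second bound is `5 * Nat.sqrt n`, which lies below `5.37 √n + 2.4`.
set_option maxRecDepth 100000 in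
lemma costTable_le_of_lt : ∀ n < 80, 5 ≤ n →
    (costTable 2 n (n - 1)).2.1 ≤ (costTable 2 n (n - 1)).2.2 ∧
    (costTable 2 n (n - 1)).2.1 ≤ Nat.sqrt n * 10 ^ 10 := by
  decide +kernel

set_option maxRecDepth 100000 in
lemma costTable_le_of_le_four : ∀ n < 5, 2 ≤ n →
    (costTable 1 n (n - 1)).2.1 ≤ (costTable 1 n (n - 1)).2.2 ∧
    (costTable 2 n (n - 1)).2.1 ≤ 8 * 10 ^ 9 := by
  decide +kernel

/-! ### A closed bound for the cost of a search in long lists -/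

/-- A bound for the expected cost of a search for `t` marked items among `n`. -/
def searchBound (n t : ℕ) : ℝ :=
  if n < 2 * t then 5.2
  else if n ≤ 4 * t then 3.9
  else if n ≤ 17 * t then 1.5 + 0.4 * ((n : ℝ) / t)
  else 1.9 * Real.sqrt ((n : ℝ) / t) + Real.logb (6 / 5) (Real.sqrt ((n : ℝ) / t) / 2) - 3.6

lemma bound_of_mid {a : ℝ} (h0 : 1 / 17 ≤ a) (h1 : a ≤ 1 / 4) :
    0 ≤ 0.4 + 1.5 * a - a * (1.5 * (1 + (1 - a * (5 - 12 * a + 8 * a ^ 2))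
      + (1 - a * (5 - 12 * a + 8 * a ^ 2)) ^ 2) + 10 * (1 - a * (5 - 12 * a + 8 * a ^ 2)) ^ 3) := by
  have hpos : ∀ x y : ℝ, 0 ≤ x → 0 ≤ y → 0 ≤ 829145204436 * y ^ 10 + 418033076335 * x * y ^ 9
      + 587096056500 * x ^ 2 * y ^ 8 + 852220835605 * x ^ 3 * y ^ 7 + 584226008320 * x ^ 4 * y ^ 6
      + 224746425984 * x ^ 5 * y ^ 5 + 53230543840 * x ^ 6 * y ^ 4 + 7956946240 * x ^ 7 * y ^ 3
      + 729784320 * x ^ 8 * y ^ 2 + 37130240 * x ^ 9 * y + 784384 * x ^ 10 := by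
    intro x y hx hy; positivity
  -- A Bernstein-type certificate: `4x + 17y = 13` allows the degree-10 polynomial to be
  -- homogenised, and all its coefficients are then nonnegative.
  have h := hpos (17 * a - 1) (1 - 4 * a) (by linarith) (by linarith)
  refine le_of_mul_le_mul_left ?_ (show (0 : ℝ) < 10 * 13 ^ 10 by norm_num)
  rw [mul_zero]
  refine h.trans (le_of_eq ?_)
  ring

lemma bound_of_few {ρ : ℝ} (h0 : 0 ≤ ρ) (h1 : ρ ≤ 17 / 70) :
    0 ≤ 1.9 - 3.6 * ρ - 1.5 * ρ * (1 + (1 - 4.29 * ρ ^ 2) + (1 - 4.29 * ρ ^ 2) ^ 2)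
      - (1 - 4.29 * ρ ^ 2) ^ 3 * (1.875 - 7.334 * ρ + 14.066 * ρ ^ 2 + 44.2 * ρ ^ 3)
      + ρ * (1 - (1 - 4.29 * ρ ^ 2) ^ 3) * (9.28 - 21.92 * ρ) := by
  have hpos : ∀ x y : ℝ, 0 ≤ x → 0 ≤ y → 0 ≤ 25000000 * y ^ 9 + 2728000000 * x * y ^ 8
      + 26537250000 * x ^ 2 * y ^ 7 + 359758700760000 * x ^ 3 * y ^ 6
      + 108047161060557500 * x ^ 4 * y ^ 5 + 13018017611674994400 * x ^ 5 * y ^ 4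
      + 820112655784423961175 * x ^ 6 * y ^ 3 + 28952278504889135341312 * x ^ 7 * y ^ 2
      + 539041876529720133558534 * x ^ 8 * y + 3941006976588348445492180 * x ^ 9 := by
    intro x y hx hy; positivity
  -- The same device in degree 9, with `70x + y = 17`; the scaling factor is `17^9 * 10^9`.
  have h := hpos ρ (17 - 70 * ρ) h0 (by linarith)
  refine le_of_mul_le_mul_left ?_ (show (0 : ℝ) < 118587876497000000000 by norm_num)
  rw [mul_zero]
  refine h.trans (le_of_eq ?_)
  ring

section

variable {n t : ℕ}

lemma searchPotential_zero : searchPotential n t 0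
    = 1.5 * (1 + firstFailure n t + firstFailure n t ^ 2)
      + firstFailure n t ^ 3 * rangePotential n t 2.0736 := by
  simp [searchPotential, Finset.sum_range_succ]

lemma firstFailure_eq : firstFailure n t = 1 - (t : ℝ) / n * (5 - 12 * ((t : ℝ) / n)
    + 8 * ((t : ℝ) / n) ^ 2) := by
  rw [firstFailure, avgSuccess_two]

lemma three_point_mono {q p W : ℝ} (hq : 0 ≤ q) (hqp : q ≤ p) (hW : 0 ≤ W) :
    1.5 * (1 + q + q ^ 2) + q ^ 3 * W ≤ 1.5 * (1 + p + p ^ 2) + p ^ 3 * W := by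
  have h2 := pow_le_pow_left₀ hq hqp 2
  have h3 := mul_le_mul_of_nonneg_right (pow_le_pow_left₀ hq hqp 3) hW
  linarith

lemma log_bound_of_le {ρ : ℝ} (h0 : 0 < ρ) (h1 : ρ ≤ 1 / 4) :
    9.28 - 21.92 * ρ ≤ Real.logb (6 / 5) (1 / (2 * ρ)) := by
  have hL := logb_const_pos
  have hlog := Real.log_le_sub_one_of_pos (show 0 < 4 * ρ by positivity)
  have h2 : Real.log (1 / (2 * ρ)) = Real.log 2 - Real.log (4 * ρ) := by
    rw [← Real.log_div two_ne_zero (by positivity)]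
    congr 1
    field_simp
    norm_num
  rw [Real.logb, le_div_iff₀ hL, h2]
  have h3 := mul_le_mul_of_nonneg_left log_const_lt.le
    (show 0 ≤ 9.28 - 21.92 * ρ by linarith)
  linarith [Real.log_two_gt_d9]

/-- Expansion in `ρ = √a` at the range `2.0736 = (6/5)^4` of the fourth cycle, using `1 / s ≤ (1 +
0.53 a) / (2ρ)`. For instance `7.334 = 2.5 * 2.0736 - 1.85 + 4`, where `4` is the logarithm of the
range. -/
lemma fewPotential_le {a : ℝ} (h0 : 0 < a) (h1 : a < 1 / 17) :
    fewPotential (doubleSine a) 2.0736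
      ≤ (1.875 - 7.334 * Real.sqrt a + 14.066 * Real.sqrt a ^ 2 + 44.2 * Real.sqrt a ^ 3)
          / Real.sqrt a + Real.logb (6 / 5) (1 / (2 * Real.sqrt a)) := by
  have hs := doubleSine_pos h0 (by linarith)
  have hsq := doubleSine_sq h0.le (by linarith)
  have hρ : 0 < Real.sqrt a := Real.sqrt_pos.2 h0
  have hρsq : Real.sqrt a ^ 2 = a := Real.sq_sqrt h0.le
  set s := doubleSine a
  set ρ := Real.sqrt a
  have hs2 : s ≤ 8 / 17 := by
    refine le_of_sq_le_sq ?_ (by norm_num)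
    rw [hsq]; nlinarith
  have hsρ : s ≤ 2 * ρ := by
    refine le_of_sq_le_sq ?_ (by positivity)
    rw [hsq, mul_pow, hρsq]; nlinarith
  have hρs : 2 * ρ ≤ s * (1 + 0.53 * a) := by
    refine le_of_sq_le_sq ?_ (by positivity)
    rw [mul_pow, mul_pow, hsq, hρsq]
    have h2 : 0 ≤ a * (a * (0.06 - 0.7791 * a - 0.2809 * a ^ 2)) := by
      have : 0 ≤ 0.06 - 0.7791 * a - 0.2809 * a ^ 2 := by nlinarith
      positivity
    nlinarith
  have hinv : 1 / s ≤ 1 / (2 * ρ) * (1 + 0.53 * a) := by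
    rw [div_mul_eq_mul_div, one_mul, div_le_div_iff₀ hs (by positivity)]
    linarith
  have hlog : Real.logb (6 / 5) (1 / (2.0736 * s))
      ≤ Real.logb (6 / 5) (1 / (2 * ρ)) + 2.92 * a - 4 := by
    have e1 : 1 / (2.0736 * s) = (1 / s) / (6 / 5) ^ 4 := by
      rw [div_div, mul_comm]; norm_num
    rw [e1, Real.logb_div (by positivity) (by positivity), Real.logb_pow,
      Real.logb_self_eq_one (by norm_num)]
    have h2 := Real.logb_le_logb_of_le (b := 6 / 5) (by norm_num) (by positivity) hinv
    rw [Real.logb_mul (by positivity) (by positivity)] at h2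
    have h3 : Real.logb (6 / 5) (1 + 0.53 * a) ≤ 2.92 * a := by
      rw [Real.logb, div_le_iff₀ logb_const_pos]
      have h4 := Real.log_le_sub_one_of_pos (show 0 < 1 + 0.53 * a by positivity)
      have h5 := mul_le_mul_of_nonneg_left log_const_gt.le (show 0 ≤ 2.92 * a by positivity)
      linarith
    norm_num at h2 h3 ⊢
    linarith
  rw [fewPotential, if_neg (by norm_num; linarith)]
  have h375 : 3.75 / s ≤ 3.75 * (1 / (2 * ρ) * (1 + 0.53 * a)) := by
    rw [div_eq_mul_one_div]
    exact mul_le_mul_of_nonneg_left hinv (by norm_num)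
  have h24 : (2.0736 * s) ^ 2 ≤ 4.299817 * (4 * a) := by
    rw [mul_pow, hsq]
    nlinarith
  have e2 : (1.875 - 7.334 * ρ + 14.066 * ρ ^ 2 + 44.2 * ρ ^ 3) / ρ
      = 1.875 * (1 / ρ) - 7.334 + 14.066 * ρ + 44.2 * ρ ^ 2 := by
    field_simp
  have e3 : 3.75 * (1 / (2 * ρ) * (1 + 0.53 * a)) = 1.875 * (1 / ρ) + 0.99375 * ρ := by
    rw [← hρsq]; field_simp; ring
  rw [e2, hρsq]
  rw [e3] at h375
  norm_num at hlog h24 h375 ⊢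
  linarith

lemma searchPotential_le (hn : 5 ≤ n) (ht : 1 ≤ t) (htn : t < n) :
    searchPotential n t 0 ≤ searchBound n t := by
  obtain ⟨h0, h1⟩ := ratio_bounds ht htn
  have hnr : (0 : ℝ) < n := by exact_mod_cast (by omega : 0 < n)
  have htr : (0 : ℝ) < t := by exact_mod_cast (by omega : 0 < t)
  have hq := firstFailure_nonneg ht htn
  have hqe := firstFailure_eq (n := n) (t := t)
  have hinv : (n : ℝ) / t = 1 / ((t : ℝ) / n) := by rw [one_div_div]
  have hW := rangePotential_nonneg ht htn (x := 2.0736) (by norm_num)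
  rw [searchPotential_zero, searchBound, rangePotential, hinv]
  rw [rangePotential] at hW
  set q := firstFailure n t
  set a := (t : ℝ) / n with ha
  have hmul : a * n = t := div_mul_cancel₀ _ hnr.ne'
  split_ifs at hW ⊢ with c1 c2 c3 c3
  · have hqb : q ≤ 0.637 := by
      have ha2 : 1 / 2 ≤ a := by
        rw [ha, le_div_iff₀ hnr]
        have : (n : ℝ) < 2 * t := by exact_mod_cast c1
        linarith
      rw [hqe]
      -- With `v = 2a - 1` the success probability is `v³ - v / 2 + 1 / 2`, least at `v = 1 / √6 ≈
      -- 0.40825`. The hint is the factorisation with this double root.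
      nlinarith [mul_nonneg (show 0 ≤ 2 * a - 1 + 0.8165 by linarith)
        (sq_nonneg (2 * a - 1 - 0.40825))]
    refine (three_point_mono hq hqb (by norm_num)).trans (by norm_num)
  · have ha1 : 1 / 4 ≤ a := by
      rw [ha, le_div_iff₀ hnr]
      have : (n : ℝ) ≤ 4 * t := by exact_mod_cast c3
      linarith
    have ha2 : a ≤ 1 / 2 := by
      rw [ha, div_le_iff₀ hnr]
      have : (2 : ℝ) * t ≤ n := by exact_mod_cast not_lt.1 c1
      linarith
    have hqb : q ≤ 1 / 2 := by
      rw [hqe]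
      nlinarith [mul_nonneg (show 0 ≤ 1 - 2 * a by linarith)
        (mul_nonneg (show 0 ≤ 1 - 2 * a by linarith) (show 0 ≤ a - 1 / 4 by linarith))]
    refine (three_point_mono hq hqb (by norm_num)).trans (by norm_num)
  · have ha1 : 1 / 17 ≤ a := by
      rw [ha, le_div_iff₀ hnr]
      have : (n : ℝ) ≤ 17 * t := by exact_mod_cast c2
      linarith
    have ha2 : a ≤ 1 / 4 := by
      rw [ha, div_le_iff₀ hnr]
      have : (4 : ℝ) * t < n := by exact_mod_cast not_le.1 c3
      linarith
    have hb := bound_of_mid ha1 ha2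
    rw [← hqe] at hb
    have h3 : q ^ 3 * (1.25 * 2.0736 + 7.4) ≤ q ^ 3 * 10 :=
      mul_le_mul_of_nonneg_left (by norm_num) (by positivity)
    refine (add_le_add le_rfl h3).trans ?_
    refine le_of_mul_le_mul_left ?_ h0
    rw [mul_add a 1.5, mul_left_comm a 0.4, mul_one_div_cancel h0.ne']
    linarith
  · omega
  · have ha1 : a < 1 / 17 := by
      rw [ha, div_lt_iff₀ hnr]
      have : (17 : ℝ) * t < n := by exact_mod_cast not_le.1 c2
      linarith
    have hρ : 0 < Real.sqrt a := Real.sqrt_pos.2 h0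
    have hρsq : Real.sqrt a ^ 2 = a := Real.sq_sqrt h0.le
    have hfew := fewPotential_le h0 ha1
    rw [Real.sqrt_div' _ h0.le, Real.sqrt_one, div_div, mul_comm (Real.sqrt a) 2]
    set ρ := Real.sqrt a
    have hρ1 : ρ ≤ 17 / 70 := by
      refine le_of_sq_le_sq ?_ (by norm_num)
      rw [hρsq]; norm_num; linarith
    have hb := bound_of_few hρ.le hρ1
    have hΛ := log_bound_of_le hρ (by linarith)
    set Λ := Real.logb (6 / 5) (1 / (2 * ρ))
    set W := fewPotential (doubleSine a) 2.0736
    have hqb : q ≤ 1 - 4.29 * ρ ^ 2 := by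
      rw [hqe, hρsq]
      nlinarith
    have hp0 : 0 ≤ 1 - 4.29 * ρ ^ 2 := hq.trans hqb
    have hp1 : (1 - 4.29 * ρ ^ 2) ^ 3 ≤ 1 :=
      pow_le_one₀ hp0 (by linarith [sq_nonneg ρ])
    refine (three_point_mono hq hqb hW).trans ?_
    set p := 1 - 4.29 * ρ ^ 2
    have h3 := mul_le_mul_of_nonneg_left hfew (pow_nonneg hp0 3)
    have h4 := mul_le_mul_of_nonneg_left hΛ (sub_nonneg.2 hp1)
    have h5 : 0 ≤ (1.9 - 3.6 * ρ - 1.5 * ρ * (1 + p + p ^ 2)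
      - p ^ 3 * (1.875 - 7.334 * ρ + 14.066 * ρ ^ 2 + 44.2 * ρ ^ 3)
      + ρ * (1 - p ^ 3) * (9.28 - 21.92 * ρ)) / ρ := div_nonneg hb hρ.le
    have h6 : (1.9 - 3.6 * ρ - 1.5 * ρ * (1 + p + p ^ 2)
      - p ^ 3 * (1.875 - 7.334 * ρ + 14.066 * ρ ^ 2 + 44.2 * ρ ^ 3)
      + ρ * (1 - p ^ 3) * (9.28 - 21.92 * ρ)) / ρ
      = 1.9 * (1 / ρ) - 3.6 - 1.5 * (1 + p + p ^ 2)
        - p ^ 3 * ((1.875 - 7.334 * ρ + 14.066 * ρ ^ 2 + 44.2 * ρ ^ 3) / ρ)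
        + (1 - p ^ 3) * (9.28 - 21.92 * ρ) := by
      field_simp
    rw [h6] at h5
    linarith

lemma logb_sqrt_div_two {y : ℝ} (hy : 0 < y) :
    Real.logb (6 / 5) (Real.sqrt y / 2)
      = (Real.log y / 2 - Real.log 2) / Real.log (6 / 5) := by
  rw [Real.logb, Real.log_div (Real.sqrt_pos.2 hy).ne' two_ne_zero, Real.log_sqrt hy.le]

lemma log_seventeen_gt : 2.8 ≤ Real.log 17 := by
  have h1 : Real.log 17 = 4 * Real.log 2 + Real.log (17 / 16) := by
    rw [show (17 : ℝ) = 2 ^ 4 * (17 / 16) by norm_num,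
      Real.log_mul (by norm_num) (by norm_num), Real.log_pow]
    norm_num
  have h2 : 1 - (17 / 16 : ℝ)⁻¹ ≤ Real.log (17 / 16) := Real.one_sub_inv_le_log_of_pos (by norm_num)
  norm_num at h1 h2 ⊢
  linarith [Real.log_two_gt_d9]

/-- The bound for few marked items is at most an affine function of `n / t`. -/
lemma few_le_affine {y : ℝ} (hy : 17 ≤ y) :
    1.9 * Real.sqrt y + Real.logb (6 / 5) (Real.sqrt y / 2) - 3.6 ≤ 1.5 + 0.4 * y := by
  have hL := logb_const_pos
  have hr : 4.12 ≤ Real.sqrt y := Real.le_sqrt_of_sq_le (by norm_num; linarith)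
  have hsq : Real.sqrt y ^ 2 = y := Real.sq_sqrt (by linarith)
  set r := Real.sqrt y
  have hlog : Real.logb (6 / 5) (r / 2) ≤ 3.803 + 5.486 * (r / 4 - 1) := by
    have h1 : Real.log (r / 2) = Real.log 2 + Real.log (r / 4) := by
      rw [← Real.log_mul two_ne_zero (by positivity)]
      congr 1; ring
    have h2 := Real.log_le_sub_one_of_pos (show 0 < r / 4 by positivity)
    rw [Real.logb, div_le_iff₀ hL, h1]
    have h3 := mul_le_mul_of_nonneg_left log_const_gt.le
      (show 0 ≤ 3.803 + 5.486 * (r / 4 - 1) by linarith)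
    linarith [Real.log_two_lt_d9]
  rw [← hsq]
  nlinarith

/-- The monotonicity that absorbs ties. Changes of regime reduce to linear inequalities; when both
values lie in the last regime, the claim rests on `√(t (t + 1)) ≤ t + 1/2` and `t log (1 + 1/t) ≤
1`. -/
lemma searchBound_mono (ht : 1 ≤ t) (htn : t + 1 < n) :
    t * searchBound n t ≤ ((t : ℝ) + 1) * searchBound n (t + 1) := by
  have htr : (1 : ℝ) ≤ t := by exact_mod_cast ht
  have htr0 : (0 : ℝ) < t := by linarith
  have hnr : (0 : ℝ) < n := by exact_mod_cast (by omega : 0 < n)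
  have e1 : (t : ℝ) * (1.5 + 0.4 * ((n : ℝ) / t)) = 1.5 * t + 0.4 * n := by
    field_simp
  have e2 : ((t : ℝ) + 1) * (1.5 + 0.4 * ((n : ℝ) / ((t : ℝ) + 1)))
      = 1.5 * (t + 1) + 0.4 * n := by
    field_simp
  have hfew : 17 * t < n → (t : ℝ) * (1.9 * Real.sqrt ((n : ℝ) / t)
      + Real.logb (6 / 5) (Real.sqrt ((n : ℝ) / t) / 2) - 3.6) ≤ 1.5 * t + 0.4 * n := by
    intro h
    rw [← e1]
    refine mul_le_mul_of_nonneg_left (few_le_affine ?_) htr0.le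
    rw [le_div_iff₀ htr0]
    exact_mod_cast h.le
  have h4 : n ≤ 4 * (t + 1) → (n : ℝ) ≤ 4 * (t + 1) := fun h => by exact_mod_cast h
  simp only [searchBound]
  push_cast
  split_ifs
  all_goals try omega
  all_goals try linarith
  all_goals try (rw [e1]; have := h4 (by omega); linarith)
  all_goals try (rw [e2]; have := hfew (by omega); linarith)
  have hy : (17 : ℝ) ≤ n / (t + 1) := by
    rw [le_div_iff₀ (by positivity)]
    have : 17 * (t + 1) < n := by omega
    exact_mod_cast this.le
  have hL := logb_const_pos
  have hr : 4.12 ≤ Real.sqrt ((n : ℝ) / (t + 1)) :=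
    Real.le_sqrt_of_sq_le (by norm_num at hy ⊢; linarith)
  have hsqrt : (t : ℝ) * Real.sqrt ((n : ℝ) / t) + Real.sqrt ((n : ℝ) / (t + 1)) / 2
      ≤ (t + 1) * Real.sqrt ((n : ℝ) / (t + 1)) := by
    have h1 : (t : ℝ) * Real.sqrt ((n : ℝ) / t) ≤ (t + 1 / 2) * Real.sqrt ((n : ℝ) / (t + 1)) := by
      refine le_of_sq_le_sq ?_ (by positivity)
      rw [mul_pow, mul_pow, Real.sq_sqrt (by positivity), Real.sq_sqrt (by positivity)]
      have : (t : ℝ) ^ 2 * (n / t) = n * t := by field_simp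
      rw [this, mul_div_assoc', le_div_iff₀ (by positivity)]
      nlinarith
    linarith
  have hlog : (t : ℝ) * Real.log ((n : ℝ) / t) - 1 + Real.log ((n : ℝ) / (t + 1))
      ≤ (t + 1) * Real.log ((n : ℝ) / (t + 1)) := by
    have h1 : Real.log ((n : ℝ) / t) = Real.log ((n : ℝ) / (t + 1)) + Real.log ((t + 1) / t) := by
      rw [← Real.log_mul (by positivity) (by positivity)]
      congr 1
      field_simp
    have h2 := Real.log_le_sub_one_of_pos (show 0 < ((t : ℝ) + 1) / t by positivity)
    have h3 : ((t : ℝ) + 1) / t - 1 = 1 / t := by field_simp; ring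
    rw [h3] at h2
    have h4 := mul_le_mul_of_nonneg_left h2 htr0.le
    rw [mul_one_div_cancel htr0.ne'] at h4
    rw [h1]
    linarith
  rw [logb_sqrt_div_two (by positivity), logb_sqrt_div_two (by positivity)]
  have hl17 : 2.8 ≤ Real.log ((n : ℝ) / (t + 1)) :=
    log_seventeen_gt.trans (Real.log_le_log (by norm_num) hy)
  set r := Real.sqrt ((n : ℝ) / (t + 1))
  set r' := Real.sqrt ((n : ℝ) / t)
  set l := Real.log ((n : ℝ) / (t + 1))
  set l' := Real.log ((n : ℝ) / t)
  set L := Real.log (6 / 5)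
  have key : 0 ≤ ((t + 1) * (l / 2 - Real.log 2) - t * (l' / 2 - Real.log 2) - 0.2) / L := by
    refine div_nonneg ?_ hL.le
    linarith [Real.log_two_lt_d9]
  have hkey2 : ((t + 1) * (l / 2 - Real.log 2) - t * (l' / 2 - Real.log 2) - 0.2) / L
      = (t + 1) * ((l / 2 - Real.log 2) / L) - t * ((l' / 2 - Real.log 2) / L) - 0.2 / L := by
    ring
  have h02 : 0 ≤ 0.2 / L := by positivity
  rw [hkey2] at key
  nlinarith

end

/-! ### Comparison of the bounds -/

/-- Here `p` is `cot θ`, which makes both sides of the comparisons with `F` rational apart from the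
logarithm. -/
lemma criticalRange_eq {n t : ℕ} (ht : 1 ≤ t) (htn : t < n) :
    ∃ p : ℝ, 0 < p ∧ p ^ 2 + 1 = (n : ℝ) / t ∧ criticalRange n t = (p ^ 2 + 1) / (2 * p) := by
  have htr : (0 : ℝ) < t := by exact_mod_cast ht
  have hnt : (0 : ℝ) < (n : ℝ) - t := sub_pos.2 (by exact_mod_cast htn)
  have hp : 0 < ((n : ℝ) - t) / t := by positivity
  have hsq : Real.sqrt (((n : ℝ) - t) / t) ^ 2 = ((n : ℝ) - t) / t := Real.sq_sqrt hp.le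
  have hy : ((n : ℝ) - t) / t + 1 = (n : ℝ) / t := by field_simp; ring
  refine ⟨Real.sqrt (((n : ℝ) - t) / t), Real.sqrt_pos.2 hp, by rw [hsq, hy], ?_⟩
  have h1 : Real.sqrt (((n : ℝ) - t) * t) = t * Real.sqrt (((n : ℝ) - t) / t) := by
    rw [show ((n : ℝ) - t) * t = t ^ 2 * (((n : ℝ) - t) / t) by field_simp,
      Real.sqrt_mul (by positivity), Real.sqrt_sq htr.le]
  have h2 := Real.sqrt_pos.2 hp
  rw [criticalRange, h1, hsq, hy]
  field_simp

lemma lt_div_of_four_mul_lt {n t : ℕ} (ht : 1 ≤ t) (h : 4 * t < n) : (4 : ℝ) < (n : ℝ) / t := by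
  rw [lt_div_iff₀ (by exact_mod_cast ht)]
  exact_mod_cast h

lemma searchBound_le_F_of_mid {n t : ℕ} (ht : 1 ≤ t) (h4 : 4 * t < n) (h17 : n ≤ 17 * t) :
    searchBound n t ≤ F n t := by
  obtain ⟨p, hp, hy, hx⟩ := criticalRange_eq ht (show t < n by omega)
  have hy4 := lt_div_of_four_mul_lt ht h4
  have hy17 : (n : ℝ) / t ≤ 17 := by
    rw [div_le_iff₀ (by exact_mod_cast ht)]
    exact_mod_cast h17
  have hp1 : 1.73 ≤ p := le_of_sq_le_sq (by norm_num; linarith) hp.le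
  have hp2 : p ≤ 4 := le_of_sq_le_sq (by norm_num; linarith) (by norm_num)
  rw [F_of_lt h4, searchBound, if_neg (by omega), if_neg (by omega), if_pos h17, ← hy, hx]
  have h1 : 1 < (p ^ 2 + 1) / (2 * p) := by
    rw [lt_div_iff₀ (by positivity)]; nlinarith
  -- Near `n = 4t` the ceiling is only known to be at least `1`; past `6 / 5` it is at least `2`,
  -- which covers the rest of the regime.
  by_cases hx2 : (p ^ 2 + 1) / (2 * p) ≤ 6 / 5
  · have hc : (1 : ℝ) ≤ (⌈Real.logb (6 / 5) ((p ^ 2 + 1) / (2 * p))⌉ : ℝ) := by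
      have : 0 < ⌈Real.logb (6 / 5) ((p ^ 2 + 1) / (2 * p))⌉ :=
        Int.ceil_pos.2 (Real.logb_pos (by norm_num) h1)
      exact_mod_cast this
    have hp3 : p ≤ 1.87 := by
      rw [div_le_iff₀ (by positivity)] at hx2
      nlinarith
    have h2 : 1.5 + 0.4 * (p ^ 2 + 1) ≤ 9 / 2 * ((p ^ 2 + 1) / (2 * p)) + 1 - 3 := by
      rw [← sub_nonneg]
      have : 9 / 2 * ((p ^ 2 + 1) / (2 * p)) + 1 - 3 - (1.5 + 0.4 * (p ^ 2 + 1))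
          = (2.25 * (p ^ 2 + 1) - 3.9 * p - 0.4 * p ^ 3) / p := by
        field_simp; ring
      rw [this]
      refine div_nonneg ?_ hp.le
      nlinarith [mul_nonneg (sub_nonneg.2 hp1) (sub_nonneg.2 hp3),
        mul_nonneg hp.le (mul_nonneg (sub_nonneg.2 hp1) (sub_nonneg.2 hp3))]
    linarith
  · have hc : (2 : ℝ) ≤ (⌈Real.logb (6 / 5) ((p ^ 2 + 1) / (2 * p))⌉ : ℝ) := by
      have : (1 : ℤ) < ⌈Real.logb (6 / 5) ((p ^ 2 + 1) / (2 * p))⌉ := by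
        rw [Int.lt_ceil, Real.lt_logb_iff_rpow_lt (by norm_num) (by positivity)]
        simpa using not_le.1 hx2
      exact_mod_cast this
    have h2 : 1.5 + 0.4 * (p ^ 2 + 1) ≤ 9 / 2 * ((p ^ 2 + 1) / (2 * p)) + 2 - 3 := by
      rw [← sub_nonneg]
      have : 9 / 2 * ((p ^ 2 + 1) / (2 * p)) + 2 - 3 - (1.5 + 0.4 * (p ^ 2 + 1))
          = (2.25 * (p ^ 2 + 1) - 2.9 * p - 0.4 * p ^ 3) / p := by
        field_simp; ring
      rw [this]
      refine div_nonneg ?_ hp.le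
      nlinarith [mul_nonneg (sub_nonneg.2 hp1) (sub_nonneg.2 hp2),
        mul_nonneg hp.le (mul_nonneg (sub_nonneg.2 hp1) (sub_nonneg.2 hp2))]
    linarith

/-- Since `criticalRange` is at least `√(n / t) / 2`, the surplus is `2.25 - 1.9` in the slope and
`3.6 - 3` in the constant. -/
lemma searchBound_add_le_F {n t : ℕ} (ht : 1 ≤ t) (h17 : 17 * t < n) :
    searchBound n t + (0.35 * Real.sqrt ((n : ℝ) / t) + 0.6) ≤ F n t := by
  obtain ⟨p, hp, hy, hx⟩ := criticalRange_eq ht (show t < n by omega)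
  rw [F_of_lt (by omega), searchBound, if_neg (by omega), if_neg (by omega), if_neg (by omega),
    hx, ← hy]
  have hr : 0 < Real.sqrt (p ^ 2 + 1) := Real.sqrt_pos.2 (by positivity)
  have hrx : Real.sqrt (p ^ 2 + 1) / 2 ≤ (p ^ 2 + 1) / (2 * p) := by
    refine le_of_sq_le_sq ?_ (by positivity)
    rw [div_pow, div_pow, Real.sq_sqrt (by positivity), div_le_div_iff₀ (by positivity)
      (by positivity)]
    nlinarith [sq_nonneg p]
  have hlog := Real.logb_le_logb_of_le (b := 6 / 5) (by norm_num) (by positivity) hrx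
  have hc := Int.le_ceil (Real.logb (6 / 5) ((p ^ 2 + 1) / (2 * p)))
  linarith

lemma sum_tail_le {n c : ℕ} (hn : 1 ≤ n) (hc : 1 ≤ c) :
    ∑ t ∈ Finset.Icc 1 (n - 1), (if n ≤ c * t then 1 / ((t : ℝ) + 1) else 0) ≤ Real.log c := by
  have hnr : (0 : ℝ) < n := by exact_mod_cast hn
  have hcr : (1 : ℝ) ≤ c := by exact_mod_cast hc
  -- The maximum with `0` covers the values of `m` for which no term is present yet.
  have key : ∀ m : ℕ, ∑ t ∈ Finset.Icc 1 m, (if n ≤ c * t then 1 / ((t : ℝ) + 1) else 0)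
      ≤ max 0 (Real.log (c * (m + 1) / n)) := by
    intro m
    induction m with
    | zero => simp
    | succ m ih =>
      have hlog : Real.log (c * ((m + 1 : ℕ) + 1) / n)
          = Real.log (c * (m + 1) / n) + Real.log (((m : ℝ) + 2) / (m + 1)) := by
        rw [← Real.log_mul (by positivity) (by positivity)]
        congr 1
        push_cast
        field_simp
        ring
      have hge : 1 / ((m : ℝ) + 2) ≤ Real.log (((m : ℝ) + 2) / (m + 1)) := by
        have h := Real.one_sub_inv_le_log_of_pos (show 0 < ((m : ℝ) + 2) / (m + 1) by positivity)
        have : 1 - (((m : ℝ) + 2) / (m + 1))⁻¹ = 1 / (m + 2) := by field_simp; ring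
        linarith
      have hpos : 0 < 1 / ((m : ℝ) + 2) := by positivity
      rw [Finset.sum_Icc_succ_top (by omega), hlog]
      split_ifs with h
      · have h1 : 0 ≤ Real.log (c * (m + 1) / n) := by
          refine Real.log_nonneg ?_
          rw [le_div_iff₀ hnr, one_mul]
          exact_mod_cast h
        rw [max_eq_right h1] at ih
        refine le_trans ?_ (le_max_right _ _)
        push_cast
        rw [show (m : ℝ) + 1 + 1 = m + 2 by ring]
        linarith
      · rw [add_zero]
        exact ih.trans (max_le_max le_rfl (by linarith))
  refine (key (n - 1)).trans (max_le (Real.log_nonneg hcr) ?_)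
  rw [Nat.cast_sub hn]
  simp [hnr.ne']

lemma sum_inv_sqrt_le (m : ℕ) :
    ∑ t ∈ Finset.Icc 1 m, 1 / (Real.sqrt t * ((t : ℝ) + 1)) ≤ 2 := by
  -- Strengthened so that the bound telescopes.
  have key : ∑ t ∈ Finset.Icc 1 m, 1 / (Real.sqrt t * ((t : ℝ) + 1))
      ≤ 2 - 2 / Real.sqrt (m + 1) := by
    induction m with
    | zero => simp
    | succ m ih =>
      rw [Finset.sum_Icc_succ_top (by omega)]
      have ha : 0 < Real.sqrt ((m : ℝ) + 1) := Real.sqrt_pos.2 (by positivity)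
      have hb : 0 < Real.sqrt ((m : ℝ) + 1 + 1) := Real.sqrt_pos.2 (by positivity)
      have hasq : Real.sqrt ((m : ℝ) + 1) ^ 2 = m + 1 := Real.sq_sqrt (by positivity)
      have hbsq : Real.sqrt ((m : ℝ) + 1 + 1) ^ 2 = m + 1 + 1 := Real.sq_sqrt (by positivity)
      have hab : Real.sqrt ((m : ℝ) + 1) ≤ Real.sqrt ((m : ℝ) + 1 + 1) :=
        Real.sqrt_le_sqrt (by linarith)
      push_cast
      set a := Real.sqrt ((m : ℝ) + 1)
      set b := Real.sqrt ((m : ℝ) + 1 + 1)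
      have h1 : 1 / (a * ((m : ℝ) + 1 + 1)) ≤ 2 / a - 2 / b := by
        rw [← hbsq, div_sub_div _ _ ha.ne' hb.ne', div_le_div_iff₀ (by positivity) (by positivity)]
        have h2 : (b - a) * (b + a) = 1 := by nlinarith
        have h3 : 1 ≤ 2 * b * (b - a) := by nlinarith
        nlinarith [mul_le_mul_of_nonneg_left h3 (mul_nonneg ha.le hb.le)]
      linarith
  have : 0 ≤ 2 / Real.sqrt ((m : ℝ) + 1) := by positivity
  linarith

section

variable {ι : Type*} [Fintype ι] [Nonempty ι]

lemma expectedQueries_le_searchBound (R : ι → ℝ) {n cq k : ℕ} (hn : Fintype.card ι = n)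
    (hn5 : 5 ≤ n) (hkq : k ≤ cq) : expectedQueries R cq k
      ≤ ENNReal.ofReal ((cq : ℝ) * ∑ t ∈ Finset.Icc 1 (n - 1), searchBound n t / ((t : ℝ) + 1)) := by
  refine expectedQueries_le_of_potential R hn (κ := 1) ?_ (searchPotential n) (searchBound n)
    (fun t u ht htn => searchPotential_nonneg hn5 ht htn u)
    (fun t u ht htn => searchPotential_step hn5 ht htn u)
    (fun t ht htn => searchPotential_le hn5 ht htn)
    (fun t ht htn => searchBound_mono ht htn)
  rw [one_mul]
  exact_mod_cast hkq

lemma expectedQueries_le_of_card_eq_one (R : ι → ℝ) {cq k : ℕ} (hn : Fintype.card ι = 1)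
    (hkq : k ≤ cq) : expectedQueries R cq k ≤ 0 := by
  have h := expectedQueries_le_of_potential R (k := k) (cq := cq) hn (κ := 1)
    (by rw [one_mul]; exact_mod_cast hkq) (fun _ _ => 0) (fun _ => 0)
    (fun t u h1 h2 => by omega) (fun t u h1 h2 => by omega) (fun t h1 h2 => by omega)
    (fun t h1 h2 => by omega)
  simpa using h

end

lemma log_four : Real.log ((4 : ℕ) : ℝ) = 2 * Real.log 2 := by
  rw [show ((4 : ℕ) : ℝ) = 2 ^ 2 by norm_num, Real.log_pow]; norm_num

/-- The termwise inequality fails where `n ≤ 4t`. The total loss there is at most `1.8656 log 4 +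
1.3 log 2 < 3.6`, with `1.8656 = 3.9 - 2.0344` and `1.3 = 5.2 - 3.9`; the terms `t ≤ 4` gain at
least `3.6` once `n ≥ 80`. -/
lemma sum_searchBound_le_sum_F {n : ℕ} (hn : 80 ≤ n) :
    ∑ t ∈ Finset.Icc 1 (n - 1), searchBound n t / ((t : ℝ) + 1)
      ≤ ∑ t ∈ Finset.Icc 1 (n - 1), F n t / ((t : ℝ) + 1) := by
  have h4 := sum_tail_le (n := n) (c := 4) (by omega) (by norm_num)
  have h2 := sum_tail_le (n := n) (c := 2) (by omega) (by norm_num)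
  have hgain : (3.6 : ℝ) ≤ ∑ t ∈ Finset.Icc 1 (n - 1),
      (if t ≤ 4 then (1.5 + 2.1 / (t : ℝ)) / ((t : ℝ) + 1) else 0) := by
    refine le_trans ?_ (Finset.sum_le_sum_of_subset_of_nonneg
      (Finset.Icc_subset_Icc_right (show 4 ≤ n - 1 by omega)) fun t _ _ => ?_)
    · norm_num [Finset.sum_Icc_succ_top]
    · split_ifs <;> positivity
  have hpt : ∀ t ∈ Finset.Icc 1 (n - 1), searchBound n t / ((t : ℝ) + 1)
      ≤ F n t / ((t : ℝ) + 1) + 1.8656 * (if n ≤ 4 * t then 1 / ((t : ℝ) + 1) else 0)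
        + 1.3 * (if n ≤ 2 * t then 1 / ((t : ℝ) + 1) else 0)
        - (if t ≤ 4 then (1.5 + 2.1 / (t : ℝ)) / ((t : ℝ) + 1) else 0) := by
    intro t ht
    obtain ⟨ht1, ht2⟩ := Finset.mem_Icc.1 ht
    have hpos : 0 < 1 / ((t : ℝ) + 1) := by positivity
    rw [div_eq_mul_one_div, div_eq_mul_one_div (F n t)]
    by_cases c : n ≤ 4 * t
    · rw [F_of_ge c, searchBound, if_pos c, if_pos c, if_neg (show ¬ t ≤ 4 by omega)]
      by_cases c' : n < 2 * t
      · rw [if_pos c', if_pos c'.le]; linarith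
      · rw [if_neg c']
        split_ifs <;> linarith
    · rw [if_neg c, if_neg (show ¬ n ≤ 2 * t by omega)]
      by_cases c' : n ≤ 17 * t
      · rw [if_neg (show ¬ t ≤ 4 by omega)]
        have := mul_le_mul_of_nonneg_right (searchBound_le_F_of_mid ht1 (by omega) c') hpos.le
        linarith
      · have hF := searchBound_add_le_F ht1 (not_le.1 c')
        split_ifs with c4
        · have hs : (0.9 + 2.1 / (t : ℝ)) / 0.35 ≤ Real.sqrt ((n : ℝ) / t) := by
            refine Real.le_sqrt_of_sq_le ?_
            have hnr : (80 : ℝ) ≤ n := by exact_mod_cast hn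
            refine le_trans ?_ (div_le_div_of_nonneg_right hnr (by positivity))
            interval_cases t <;> norm_num
          have hs' := mul_le_mul_of_nonneg_left hs (show (0 : ℝ) ≤ 0.35 by norm_num)
          rw [mul_div_cancel₀ _ (by norm_num)] at hs'
          have := mul_le_mul_of_nonneg_right
            (show searchBound n t + (1.5 + 2.1 / (t : ℝ)) ≤ F n t by linarith) hpos.le
          rw [div_eq_mul_one_div (1.5 + 2.1 / (t : ℝ))]
          linarith
        · have : searchBound n t ≤ F n t := by
            have := Real.sqrt_nonneg ((n : ℝ) / t)
            linarith
          have := mul_le_mul_of_nonneg_right this hpos.le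
          linarith
  refine (Finset.sum_le_sum hpt).trans ?_
  rw [Finset.sum_sub_distrib, Finset.sum_add_distrib, Finset.sum_add_distrib, ← Finset.mul_sum,
    ← Finset.mul_sum]
  rw [log_four] at h4
  push_cast at h2
  linarith [Real.log_two_lt_d9]

lemma searchBound_le_sqrt {n t : ℕ} (ht : 1 ≤ t) (htn : t < n) :
    searchBound n t ≤ 2.5 * Real.sqrt ((n : ℝ) / t) + 2.7 * (if n ≤ 4 * t then 1 else 0) := by
  have htr : (0 : ℝ) < t := by exact_mod_cast ht
  have hy1 : 1 ≤ (n : ℝ) / t := by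
    rw [le_div_iff₀ htr, one_mul]; exact_mod_cast htn.le
  have hr1 : 1 ≤ Real.sqrt ((n : ℝ) / t) := Real.le_sqrt_of_sq_le (by linarith)
  have hsq : Real.sqrt ((n : ℝ) / t) ^ 2 = (n : ℝ) / t := Real.sq_sqrt (by positivity)
  rw [searchBound]
  by_cases c : n ≤ 4 * t
  · rw [if_pos c, if_pos c]
    split_ifs <;> linarith
  rw [if_neg c, if_neg c, if_neg (by omega)]
  have hy4 := lt_div_of_four_mul_lt ht (not_le.1 c)
  have hr2 : 2 ≤ Real.sqrt ((n : ℝ) / t) := Real.le_sqrt_of_sq_le (by linarith)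
  split_ifs with c'
  · have hy17 : (n : ℝ) / t ≤ 17 := by
      rw [div_le_iff₀ htr]
      exact_mod_cast c'
    set r := Real.sqrt ((n : ℝ) / t)
    rw [← hsq] at hy17 ⊢
    have : r ≤ 5 := by nlinarith
    nlinarith
  · set r := Real.sqrt ((n : ℝ) / t)
    have hL := logb_const_pos
    have hlog : ∀ j : ℕ, Real.log (r / 2) ≤ j * Real.log 2 + (r / 2 ^ (j + 1) - 1) := by
      intro j
      have h1 := Real.log_le_sub_one_of_pos (show 0 < r / 2 ^ (j + 1) by positivity)
      have h2 : Real.log (r / 2) = Real.log (2 ^ j) + Real.log (r / 2 ^ (j + 1)) := by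
        rw [← Real.log_mul (by positivity) (by positivity), pow_succ]
        congr 1
        field_simp
      rw [h2, Real.log_pow]
      linarith
    have hb : Real.logb (6 / 5) (r / 2) ≤ 0.6 * r + 3.6 := by
      rw [Real.logb, div_le_iff₀ hL]
      have h3 := mul_le_mul_of_nonneg_left log_const_gt.le (show 0 ≤ 0.6 * r + 3.6 by linarith)
      refine le_trans ?_ h3
      have h2 := hlog 2
      have h4 := hlog 3
      norm_num at h2 h4
      by_cases hr : r ≤ 14
      · linarith [Real.log_two_lt_d9]
      · linarith [Real.log_two_lt_d9]
    linarith

lemma sum_searchBound_le {n : ℕ} (hn : 1 ≤ n) :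
    ∑ t ∈ Finset.Icc 1 (n - 1), searchBound n t / ((t : ℝ) + 1) ≤ 5 * Real.sqrt n + 3.75 := by
  have hpt : ∀ t ∈ Finset.Icc 1 (n - 1), searchBound n t / ((t : ℝ) + 1)
      ≤ 2.5 * Real.sqrt n * (1 / (Real.sqrt t * ((t : ℝ) + 1)))
        + 2.7 * (if n ≤ 4 * t then 1 / ((t : ℝ) + 1) else 0) := by
    intro t ht
    obtain ⟨ht1, ht2⟩ := Finset.mem_Icc.1 ht
    have htr : (0 : ℝ) < t := by exact_mod_cast ht1
    have h := div_le_div_of_nonneg_right (searchBound_le_sqrt ht1 (show t < n by omega))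
      (show 0 ≤ (t : ℝ) + 1 by positivity)
    refine h.trans (le_of_eq ?_)
    have hs : 0 < Real.sqrt t := Real.sqrt_pos.2 htr
    rw [Real.sqrt_div' _ htr.le]
    split_ifs <;> field_simp
    ring
  refine (Finset.sum_le_sum hpt).trans ?_
  rw [Finset.sum_add_distrib, ← Finset.mul_sum, ← Finset.mul_sum]
  have h1 := mul_le_mul_of_nonneg_left (sum_inv_sqrt_le (n - 1))
    (show 0 ≤ 2.5 * Real.sqrt n by positivity)
  have h4 := sum_tail_le (n := n) (c := 4) (by omega) (by norm_num)
  rw [log_four] at h4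
  linarith [Real.log_two_lt_d9]

lemma F_le_sqrt {n t : ℕ} (ht : 1 ≤ t) (h4 : 4 * t < n) :
    F n t ≤ 9.2 / 3 * Real.sqrt ((n : ℝ) / t) := by
  obtain ⟨p, hp, hy, hx⟩ := criticalRange_eq ht (show t < n by omega)
  have hy4 := lt_div_of_four_mul_lt ht h4
  have hL := logb_const_pos
  have hr : 2 ≤ Real.sqrt ((n : ℝ) / t) := Real.le_sqrt_of_sq_le (by linarith)
  have hsq : Real.sqrt ((n : ℝ) / t) ^ 2 = (n : ℝ) / t := Real.sq_sqrt (by positivity)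
  rw [F_of_lt h4, hx]
  set r := Real.sqrt ((n : ℝ) / t)
  -- The logarithm is then bounded by its tangent at `x = 2` for `r ≤ 5` and at `x = 4` for larger
  -- `r`.
  have hxr : (p ^ 2 + 1) / (2 * p) ≤ r / 2 + 0.31 / r := by
    refine le_of_sq_le_sq ?_ (by positivity)
    have h1 : (r / 2 + 0.31 / r) ^ 2 = r ^ 2 / 4 + 0.31 + 0.0961 / r ^ 2 := by field_simp; ring
    rw [h1, hsq, ← hy, div_pow, ← sub_nonneg]
    have h2 : (p ^ 2 + 1) / 4 + 0.31 + 0.0961 / (p ^ 2 + 1) - (p ^ 2 + 1) ^ 2 / (2 * p) ^ 2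
        = ((0.06 * p ^ 2 - 0.25) * (p ^ 2 + 1) + 0.0961 * p ^ 2) / (p ^ 2 * (p ^ 2 + 1)) := by
      field_simp; ring
    rw [h2]
    have hp3 : 3 ≤ p ^ 2 := by linarith
    refine div_nonneg ?_ (by positivity)
    nlinarith
  have h1 : 1 ≤ (p ^ 2 + 1) / (2 * p) := by
    rw [le_div_iff₀ (by positivity)]; nlinarith [sq_nonneg (p - 1)]
  set x := (p ^ 2 + 1) / (2 * p)
  have hc := Int.ceil_lt_add_one (Real.logb (6 / 5) x)
  have hlog : ∀ j : ℕ, Real.log x ≤ j * Real.log 2 + (x / 2 ^ j - 1) := by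
    intro j
    have h1 := Real.log_le_sub_one_of_pos (show 0 < x / 2 ^ j by positivity)
    have h2 : Real.log x = Real.log (2 ^ j) + Real.log (x / 2 ^ j) := by
      rw [← Real.log_mul (by positivity) (by positivity)]
      congr 1
      field_simp
    rw [h2, Real.log_pow]
    linarith
  have hinv : 0.31 / r ≤ 0.155 := by
    rw [div_le_iff₀ (by positivity)]; linarith
  by_cases hr5 : r ≤ 5
  · have hb : Real.logb (6 / 5) x ≤ -1.683 + 2.744 * x := by
      rw [Real.logb, div_le_iff₀ hL]
      have h3 := mul_le_mul_of_nonneg_left log_const_gt.le (show 0 ≤ -1.683 + 2.744 * x by linarith)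
      have h2 := hlog 1
      norm_num at h2 h3 ⊢
      linarith [Real.log_two_lt_d9]
    have h6 : 7.244 * (0.31 / r) ≤ 7.244 * (0.2868 - 0.06293 * r + 0.0046 * r ^ 2) := by
      refine mul_le_mul_of_nonneg_left ?_ (by norm_num)
      rw [div_le_iff₀ (by positivity)]
      nlinarith [mul_nonneg (sub_nonneg.2 hr) (sub_nonneg.2 hr5),
        mul_nonneg (mul_nonneg (sub_nonneg.2 hr) (sub_nonneg.2 hr5)) (by linarith : 0 ≤ r)]
    norm_num at *
    nlinarith [mul_nonneg (sub_nonneg.2 hr) (sub_nonneg.2 hr5)]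
  · have hb : Real.logb (6 / 5) x ≤ 2.12 + 1.372 * x := by
      rw [Real.logb, div_le_iff₀ hL]
      have h3 := mul_le_mul_of_nonneg_left log_const_gt.le (show 0 ≤ 2.12 + 1.372 * x by linarith)
      have h2 := hlog 2
      norm_num at h2 h3 ⊢
      linarith [Real.log_two_lt_d9]
    have h6 : 0.31 / r ≤ 0.062 := by
      rw [div_le_iff₀ (by positivity)]; linarith
    norm_num at *
    linarith

lemma sum_F_le {n : ℕ} (hn : 1 ≤ n) :
    ∑ t ∈ Finset.Icc 1 (n - 1), F n t / ((t : ℝ) + 1)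
      ≤ 9.2 * Real.sqrt n / 3
          * ∑ t ∈ Finset.Icc 1 (⌈(n : ℝ) / 4⌉₊ - 1), 1 / (Real.sqrt t * ((t : ℝ) + 1))
        + 2.0344 * ∑ t ∈ Finset.Icc ⌈(n : ℝ) / 4⌉₊ (n - 1), 1 / ((t : ℝ) + 1) := by
  have hc : ⌈(n : ℝ) / 4⌉₊ = (n + 3) / 4 := by
    have := ceil_div_eq n 4 (by norm_num)
    push_cast at this
    rw [this]
  have hsplit : Finset.Icc 1 (n - 1)
      = Finset.Icc 1 ((n + 3) / 4 - 1) ∪ Finset.Icc ((n + 3) / 4) (n - 1) := by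
    ext t
    simp only [Finset.mem_union, Finset.mem_Icc]
    omega
  have hdisj : Disjoint (Finset.Icc 1 ((n + 3) / 4 - 1)) (Finset.Icc ((n + 3) / 4) (n - 1)) := by
    rw [Finset.disjoint_left]
    intro t h1 h2
    simp only [Finset.mem_Icc] at h1 h2
    omega
  rw [hc, hsplit, Finset.sum_union hdisj, Finset.mul_sum, Finset.mul_sum]
  refine add_le_add (Finset.sum_le_sum fun t ht => ?_) (Finset.sum_le_sum fun t ht => ?_)
  · rw [Finset.mem_Icc] at ht
    have htr : (0 : ℝ) < t := by exact_mod_cast (by omega : 0 < t)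
    have hs : 0 < Real.sqrt t := Real.sqrt_pos.2 htr
    have h := div_le_div_of_nonneg_right (F_le_sqrt (n := n) (t := t) ht.1 (by omega))
      (show 0 ≤ (t : ℝ) + 1 by positivity)
    refine h.trans (le_of_eq ?_)
    rw [Real.sqrt_div' _ htr.le]
    field_simp
  · rw [Finset.mem_Icc] at ht
    rw [F_of_ge (by omega), mul_one_div]

/-! ### The dilogarithm -/

lemma log_one_sub_div_mem {s : ℝ} (hs : s ≤ 0) :
    -1 ≤ Real.log (1 - s) / s ∧ Real.log (1 - s) / s ≤ 0 := by
  rcases hs.eq_or_lt with rfl | hs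
  · norm_num
  have h1 := Real.log_le_sub_one_of_pos (show 0 < 1 - s by linarith)
  have h2 := Real.log_nonneg (show 1 ≤ 1 - s by linarith)
  exact ⟨by rw [le_div_iff_of_neg hs]; linarith, div_nonpos_of_nonneg_of_nonpos h2 hs.le⟩

lemma intervalIntegrable_log_one_sub_div {a b : ℝ} (ha : a ≤ b) (hb : b ≤ 0) :
    IntervalIntegrable (fun s => Real.log (1 - s) / s) MeasureTheory.volume a b := by
  rw [intervalIntegrable_iff_integrableOn_Ioc_of_le ha]
  refine MeasureTheory.Measure.integrableOn_of_bounded (M := 1) (by simp) ?_ ?_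
  · exact ((Real.measurable_log.comp (measurable_const.sub measurable_id)).div
      measurable_id).aestronglyMeasurable
  · refine (MeasureTheory.ae_restrict_mem measurableSet_Ioc).mono fun s hs => ?_
    have h := log_one_sub_div_mem (hs.2.trans hb)
    rw [Real.norm_eq_abs, abs_le]
    exact ⟨h.1, h.2.trans (by norm_num)⟩

/-- On `[-1, 0]` the integrand is at least `-1`; on `[-x, -1]` the numerator is at most `log (1 +
x)`, and `1 / s` integrates to `-log x`. -/
lemma dilog_neg_ge {x : ℝ} (hx : 1 ≤ x) :
    -(1 + Real.log (1 + x) * Real.log x) ≤ dilog (-x) := by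
  rw [dilog, ← intervalIntegral.integral_symm, ← intervalIntegral.integral_add_adjacent_intervals
    (intervalIntegrable_log_one_sub_div (a := -x) (b := -1) (by linarith) (by norm_num))
    (intervalIntegrable_log_one_sub_div (a := -1) (b := 0) (by norm_num) le_rfl)]
  have hint : IntervalIntegrable (fun s : ℝ => Real.log (1 + x) * s⁻¹) MeasureTheory.volume
      (-x) (-1) := by
    refine (ContinuousOn.intervalIntegrable ?_)
    refine continuousOn_const.mul (continuousOn_id.inv₀ fun s hs => ?_)
    rw [Set.uIcc_of_le (by linarith)] at hs
    exact (lt_of_le_of_lt hs.2 (by norm_num)).ne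
  have h1 : -(Real.log (1 + x) * Real.log x) ≤ ∫ s in (-x)..(-1), Real.log (1 - s) / s := by
    have h := intervalIntegral.integral_mono_on (show -x ≤ -1 by linarith) hint
      (intervalIntegrable_log_one_sub_div (by linarith) (by norm_num)) (fun s hs => by
        have hs0 : s < 0 := lt_of_le_of_lt hs.2 (by norm_num)
        have h2 := Real.log_le_log (show 0 < 1 - s by linarith) (show 1 - s ≤ 1 + x by linarith [hs.1])
        rw [div_eq_mul_inv]
        exact mul_le_mul_of_nonpos_right h2 (inv_nonpos.2 hs0.le))
    refine le_trans (le_of_eq ?_) h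
    rw [intervalIntegral.integral_const_mul, integral_inv_of_neg (by linarith) (by norm_num)]
    rw [neg_div_neg_eq, Real.log_div one_ne_zero (by linarith), Real.log_one]
    ring
  have h2 : -1 ≤ ∫ s in (-1 : ℝ)..0, Real.log (1 - s) / s := by
    have h := intervalIntegral.integral_mono_on (show (-1 : ℝ) ≤ 0 by norm_num)
      (intervalIntegrable_const (c := (-1 : ℝ)))
      (intervalIntegrable_log_one_sub_div (by norm_num) le_rfl)
      (fun s hs => (log_one_sub_div_mem hs.2).1)
    simpa using h
  linarith

/-! ### The bound with the dilogarithm -/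

/-- The last bound of the main theorem, divided by the cost of an oracle use. -/
def dilogBound (n : ℕ) : ℝ :=
  3 * Real.sqrt 3 * (1 + Real.pi) / 4 * Real.sqrt n
    + Real.log ((n : ℝ) / 4) / (2 * Real.log (6 / 5))
      * (Real.log ((n : ℝ) / 3) + Real.log ((n : ℝ) / 4 + 1))
    - 2 * Real.log ((n : ℝ) / 4) + 5.3482
    + dilog (-(⌈(n : ℝ) / 4⌉₊ : ℝ) + 1) / (2 * Real.log (6 / 5))

lemma dilog_const_ge : 5.37 ≤ 3 * Real.sqrt 3 * (1 + Real.pi) / 4 := by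
  have h3 : 1.732 ≤ Real.sqrt 3 := Real.le_sqrt_of_sq_le (by norm_num)
  have := mul_le_mul h3 (show 4.14 ≤ 1 + Real.pi by linarith [Real.pi_gt_d2]) (by norm_num)
    (by positivity)
  linarith

lemma le_dilogBound {n : ℕ} (hn : 5 ≤ n) : 5.37 * Real.sqrt n + 2.4 ≤ dilogBound n := by
  have hnr : (5 : ℝ) ≤ n := by exact_mod_cast hn
  have hL := logb_const_pos
  have hc := mul_le_mul_of_nonneg_right dilog_const_ge (Real.sqrt_nonneg n)
  have hl : 0 ≤ Real.log ((n : ℝ) / 4) := Real.log_nonneg (by linarith)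
  have hl3 : Real.log ((n : ℝ) / 4) + 1 / 4 ≤ Real.log ((n : ℝ) / 3) := by
    have h1 : Real.log ((n : ℝ) / 3) = Real.log ((n : ℝ) / 4) + Real.log (4 / 3) := by
      rw [← Real.log_mul (by positivity) (by norm_num)]
      congr 1
      ring
    have h2 := Real.one_sub_inv_le_log_of_pos (show (0 : ℝ) < 4 / 3 by norm_num)
    norm_num at h2
    linarith
  have hdilog : -(1 + Real.log ((n : ℝ) / 4 + 1) * Real.log ((n : ℝ) / 4))
      ≤ dilog (-(⌈(n : ℝ) / 4⌉₊ : ℝ) + 1) := by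
    have h2 : (2 : ℝ) ≤ ⌈(n : ℝ) / 4⌉₊ := by
      have : 1 < ⌈(n : ℝ) / 4⌉₊ := Nat.lt_ceil.2 (by norm_num; linarith)
      exact_mod_cast this
    have h3 : (⌈(n : ℝ) / 4⌉₊ : ℝ) < n / 4 + 1 := Nat.ceil_lt_add_one (by positivity)
    have h := dilog_neg_ge (x := (⌈(n : ℝ) / 4⌉₊ : ℝ) - 1) (by linarith)
    rw [neg_sub, show (1 : ℝ) - ⌈(n : ℝ) / 4⌉₊ = -⌈(n : ℝ) / 4⌉₊ + 1 by ring] at h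
    refine le_trans (neg_le_neg ?_) h
    refine add_le_add le_rfl (mul_le_mul (Real.log_le_log (by linarith) (by linarith))
      (Real.log_le_log (by linarith) (by linarith)) (Real.log_nonneg (by linarith))
      (Real.log_nonneg (by linarith)))
  rw [dilogBound]
  set l := Real.log ((n : ℝ) / 4)
  set l' := Real.log ((n : ℝ) / 4 + 1)
  set D := dilog (-(⌈(n : ℝ) / 4⌉₊ : ℝ) + 1)
  have hkey : 2.4 ≤ l / (2 * Real.log (6 / 5)) * (Real.log ((n : ℝ) / 3) + l') - 2 * l + 5.3482
      + D / (2 * Real.log (6 / 5)) := by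
    have h1 : l / (2 * Real.log (6 / 5)) * (Real.log ((n : ℝ) / 3) + l') - 2 * l + 5.3482
      + D / (2 * Real.log (6 / 5)) - 2.4 = (l * (Real.log ((n : ℝ) / 3) + l')
        + 2 * (2.9482 - 2 * l) * Real.log (6 / 5) + D) / (2 * Real.log (6 / 5)) := by
      field_simp
      ring
    rw [← sub_nonneg, h1]
    refine div_nonneg ?_ (by positivity)
    have h2 := mul_le_mul_of_nonneg_left hl3 hl
    have h3 := mul_le_mul_of_nonneg_left log_const_lt.le hl
    -- The dilogarithm bound cancels `l * l'`. What remains is a quadratic in `l`, about `l² - 0.479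
    -- l + 0.075`, whose minimum near `l = 0.24` is barely positive.
    nlinarith [sq_nonneg (l - 0.24), log_const_gt]
  linarith

/-- Here `⌈n / 4⌉ = 1`, so the dilogarithm vanishes, and `log (n / 4) ≤ 0` makes the term `-2 log (n
/ 4)` nonnegative. -/
lemma dilogBound_ge_four {n : ℕ} (h2 : 2 ≤ n) (h4 : n ≤ 4) : 4 ≤ dilogBound n := by
  have hnr : (2 : ℝ) ≤ n := by exact_mod_cast h2
  have hnr4 : (n : ℝ) ≤ 4 := by exact_mod_cast h4
  have hL := logb_const_pos
  have hs : 1 ≤ Real.sqrt n := Real.le_sqrt_of_sq_le (by linarith)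
  have hc := mul_le_mul dilog_const_ge hs (by norm_num)
    (le_trans (by norm_num) dilog_const_ge)
  have hceil : ⌈(n : ℝ) / 4⌉₊ = 1 :=
    (Nat.ceil_eq_iff (by norm_num)).2 ⟨by norm_num; linarith, by norm_num; linarith⟩
  have hl : Real.log ((n : ℝ) / 4) ≤ 0 := Real.log_nonpos (by positivity) (by linarith)
  have hprod : -1 ≤ Real.log ((n : ℝ) / 4) / (2 * Real.log (6 / 5))
      * (Real.log ((n : ℝ) / 3) + Real.log ((n : ℝ) / 4 + 1)) := by
    rw [div_mul_eq_mul_div, le_div_iff₀ (by positivity)]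
    interval_cases n
    · have h1 : Real.log (((2 : ℕ) : ℝ) / 3) + Real.log (((2 : ℕ) : ℝ) / 4 + 1) = 0 := by
        rw [← Real.log_mul (by norm_num) (by norm_num)]
        norm_num
      rw [h1, mul_zero]
      linarith
    · have h1 := Real.one_sub_inv_le_log_of_pos (show 0 < ((3 : ℕ) : ℝ) / 4 by norm_num)
      have h5 := Real.log_le_sub_one_of_pos (show 0 < ((3 : ℕ) : ℝ) / 4 + 1 by norm_num)
      have h6 : 0 ≤ Real.log (((3 : ℕ) : ℝ) / 4 + 1) := Real.log_nonneg (by norm_num)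
      have h3 : Real.log (((3 : ℕ) : ℝ) / 3) = 0 := by norm_num
      rw [h3, zero_add]
      norm_num at h1 h5 h6 hl ⊢
      nlinarith [log_const_gt]
    · have h1 : Real.log (((4 : ℕ) : ℝ) / 4) = 0 := by norm_num
      rw [h1, zero_mul]
      linarith
  rw [dilogBound, hceil]
  have h0 : dilog (-((1 : ℕ) : ℝ) + 1) = 0 := by simp [dilog]
  rw [h0, zero_div]
  linarith

/-! ### The bounds for lists of every length -/

section

variable {ι : Type*} [Fintype ι] [Nonempty ι]

lemma le_ofReal_mul_of_le {E : ℝ≥0∞} {c a b : ℝ} (hc : 0 ≤ c) (h : E ≤ ENNReal.ofReal (c * a))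
    (hab : a ≤ b) : E ≤ ENNReal.ofReal (c * b) :=
  h.trans (ENNReal.ofReal_le_ofReal (mul_le_mul_of_nonneg_left hab hc))

lemma expectedQueries_le_sum_F (R : ι → ℝ) {n cq k : ℕ} (hn : Fintype.card ι = n) (hkq : k ≤ cq)
    (h : 5 ≤ n ∨ 2 * k ≤ cq) : expectedQueries R cq k
      ≤ ENNReal.ofReal ((cq : ℝ) * ∑ t ∈ Finset.Icc 1 (n - 1), F n t / ((t : ℝ) + 1)) := by
  have hcq : (0 : ℝ) ≤ cq := cq.cast_nonneg
  have hn0 : 0 < n := hn ▸ Fintype.card_pos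
  by_cases h80 : 80 ≤ n
  · exact le_ofReal_mul_of_le hcq (expectedQueries_le_searchBound R hn (by omega) hkq)
      (sum_searchBound_le_sum_F h80)
  by_cases h5 : 5 ≤ n
  · refine le_ofReal_mul_of_le hcq (expectedQueries_le_costTable R (c := 2) hn (by omega)
      (by omega) (by omega) (failUpper_lt n (by omega) (by omega))) ?_
    refine le_trans (div_le_div_of_nonneg_right ?_ (by norm_num))
      (costTable_lower (c := 2) (n := n) (t := n - 1) (by omega))
    exact_mod_cast (costTable_le_of_lt n (by omega) h5).1
  by_cases h2 : 2 ≤ n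
  · refine le_ofReal_mul_of_le hcq (expectedQueries_le_costTable R (c := 1) hn (by omega)
      (by omega) (by omega) (failUpper_lt n (by omega) (by omega))) ?_
    refine le_trans (div_le_div_of_nonneg_right ?_ (by norm_num))
      (costTable_lower (c := 1) (n := n) (t := n - 1) (by omega))
    exact_mod_cast (costTable_le_of_le_four n (by omega) h2).1
  · exact (expectedQueries_le_of_card_eq_one R (by omega) hkq).trans bot_le

lemma expectedQueries_le_sqrt (R : ι → ℝ) {n cq k : ℕ} (hn : Fintype.card ι = n) (hn5 : 5 ≤ n)
    (hkq : k ≤ cq) :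
    expectedQueries R cq k ≤ ENNReal.ofReal ((cq : ℝ) * (5.37 * Real.sqrt n + 2.4)) := by
  have hcq : (0 : ℝ) ≤ cq := cq.cast_nonneg
  have hs := Real.sqrt_nonneg (n : ℝ)
  by_cases h80 : 80 ≤ n
  · refine le_ofReal_mul_of_le hcq (expectedQueries_le_searchBound R hn (by omega) hkq)
      ((sum_searchBound_le (by omega)).trans ?_)
    have hnr : (80 : ℝ) ≤ n := by exact_mod_cast h80
    have : 8 ≤ Real.sqrt n := Real.le_sqrt_of_sq_le (by linarith)
    linarith
  · refine le_ofReal_mul_of_le hcq (expectedQueries_le_costTable R (c := 2) hn (by omega)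
      (by omega) (by omega) (failUpper_lt n (by omega) (by omega))) ?_
    have h1 : ((costTable 2 n (n - 1)).2.1 : ℝ) ≤ Nat.sqrt n * 10 ^ 10 := by
      exact_mod_cast (costTable_le_of_lt n (by omega) hn5).2
    have h2 : (Nat.sqrt n : ℝ) ≤ Real.sqrt n := Real.nat_sqrt_le_real_sqrt
    rw [div_le_iff₀ (by norm_num)]
    linarith

lemma expectedQueries_le_four (R : ι → ℝ) {n cq k : ℕ} (hn : Fintype.card ι = n) (h2 : 2 ≤ n)
    (h4 : n ≤ 4) (hkq : k ≤ cq) : expectedQueries R cq k ≤ ENNReal.ofReal ((cq : ℝ) * 4) := by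
  refine le_ofReal_mul_of_le cq.cast_nonneg (expectedQueries_le_costTable R (c := 2) hn h2
    (by omega) (by omega) (failUpper_lt n (by omega) h2)) ?_
  have h1 : ((costTable 2 n (n - 1)).2.1 : ℝ) ≤ 8 * 10 ^ 9 := by
    exact_mod_cast (costTable_le_of_le_four n (by omega) h2).2
  rw [div_le_iff₀ (by norm_num)]
  linarith

end

end QMax

end

theorem mainTheorem2 {ι : Type*} [Fintype ι] [Nonempty ι] (R : ι → ℝ) (n : ℕ)
    (hn : Fintype.card ι = n) (cq k : ℕ) (hk : 1 ≤ k) (hkq : k ≤ cq) :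
    ((5 ≤ n ∨ 2 * k ≤ cq) →
      QMax.expectedQueries R cq k
        ≤ ENNReal.ofReal ((cq : ℝ) * ∑ t ∈ Finset.Icc 1 (n - 1), QMax.F n t / ((t : ℝ) + 1)) ∧
      QMax.expectedQueries R cq k
        ≤ ENNReal.ofReal ((cq : ℝ) *
          (9.2 * Real.sqrt n / 3
              * ∑ t ∈ Finset.Icc 1 (⌈(n : ℝ) / 4⌉₊ - 1), 1 / (Real.sqrt t * ((t : ℝ) + 1))
            + 2.0344 * ∑ t ∈ Finset.Icc ⌈(n : ℝ) / 4⌉₊ (n - 1), 1 / ((t : ℝ) + 1)))) ∧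
    QMax.expectedQueries R cq k
      ≤ ENNReal.ofReal ((cq : ℝ) * (6.3505 * Real.sqrt n + 2.8203)) ∧
    QMax.expectedQueries R cq k
      ≤ ENNReal.ofReal ((cq : ℝ) *
        (3 * Real.sqrt 3 * (1 + Real.pi) / 4 * Real.sqrt n
          + Real.log ((n : ℝ) / 4) / (2 * Real.log (6 / 5))
            * (Real.log ((n : ℝ) / 3) + Real.log ((n : ℝ) / 4 + 1))
          - 2 * Real.log ((n : ℝ) / 4) + 5.3482
          + QMax.dilog (-(⌈(n : ℝ) / 4⌉₊ : ℝ) + 1) / (2 * Real.log (6 / 5)))) := by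
  have hcq : (0 : ℝ) ≤ cq := cq.cast_nonneg
  have hn0 : 1 ≤ n := hn ▸ Fintype.card_pos
  have hs := Real.sqrt_nonneg (n : ℝ)
  refine ⟨fun h => ?_, ?_, ?_⟩
  · have h1 := QMax.expectedQueries_le_sum_F R hn hkq h
    exact ⟨h1, QMax.le_ofReal_mul_of_le hcq h1 (QMax.sum_F_le hn0)⟩
  · rcases le_or_gt 5 n with h5 | h5
    · exact QMax.le_ofReal_mul_of_le hcq (QMax.expectedQueries_le_sqrt R hn h5 hkq) (by linarith)
    rcases le_or_gt 2 n with h2 | h2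
    · refine QMax.le_ofReal_mul_of_le hcq
        (QMax.expectedQueries_le_four R hn h2 (by omega) hkq) ?_
      have : 1 ≤ Real.sqrt n := Real.one_le_sqrt.2 (by exact_mod_cast hn0)
      linarith
    · exact (QMax.expectedQueries_le_of_card_eq_one R (by omega) hkq).trans bot_le
  · rcases le_or_gt 5 n with h5 | h5
    · exact QMax.le_ofReal_mul_of_le hcq (QMax.expectedQueries_le_sqrt R hn h5 hkq)
        (QMax.le_dilogBound h5)
    rcases le_or_gt 2 n with h2 | h2
    · exact QMax.le_ofReal_mul_of_le hcq (QMax.expectedQueries_le_four R hn h2 (by omega) hkq)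
        (QMax.dilogBound_ge_four h2 (by omega))
    · exact (QMax.expectedQueries_le_of_card_eq_one R (by omega) hkq).trans bot_le
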